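/- Let $\phi,\psi:[0,1]\to\mathbb R$ be continuous on $[0,1]$ and twice continuously differentiable on $(0,1]$ (one-sidedly at $1$), with $\phi$ concave, $\phi(0)=\phi(1)=0$, $-1<\phi'(1)<0$ (D1), and $\psi$ convex, $\psi(1)=0$, $\psi'(1)<0$, $\psi''(1)-\phi''(1)>0$ (E1). Let $c_0\ge 0$ be an integrable function on $[0,1)$ such that $w_0(x)=\int_x^1c_0(x')\,dx'>0$ for $0\le x<1$, put $h_0(x)=\int_x^1w_0(x')\,dx'$, and assume that the beta function $\beta(x,0)=c_0(x)h_0(x)/w_0(x)^2$ of the initial data satisfies $\lim_{x\to1}\beta(x,0)=\beta_0$ with $0<\beta_0<1$. Let $w(x,t)$, $0\le x<1$, $t\ge0$, together with the continuous function $\kappa:[0,\infty)\to\mathbb R$, be the solution of $$\frac{\partial w}{\partial t}+[\phi(x)-\kappa(t)\psi(x)]\frac{\partial w}{\partial x}=w,\qquad \int_0^1w(x,t)\,dx=1,\qquad w(x,0)=w_0(x).$$ Here the transport equation is understood along characteristics: every $(x,t)$ with $0\le x<1$, $t\ge 0$ is the end point $X(t)=x$ of a curve $X:[0,t]\to[0,1)$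 with $X'(s)=\phi(X(s))-\kappa(s)\psi(X(s))$ and $\frac{d}{ds}w(X(s),s)=w(X(s),s)$; equivalently, $w(x,t)=e^tw_0(X(0))$. Then there is a constant $C_1>0$, depending only on the initial data (and on the fixed coefficients $\phi,\psi$), such that $\kappa(t)\ge C_1$ for all $t\ge0$. If in addition $\phi,\psi$ are $C^3$ on $(0,1]$ with $\phi'''(x)\ge0$ and $\psi'''(x)\le0$ for $0<x\le1$ (O1), then there is a constant $C_2>0$, depending only on the initial data (and on $\phi,\psi$), such that $\kappa(t)\le C_2$ for all $t\ge0$, and $$\lim_{T\to\infty}\frac1T\int_0^T\kappa(t)\,dt=\frac{1/\beta_0-\phi'(1)-1}{|\psi'(1)|}.$$ -/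

import Mathlib

open Set Filter Topology MeasureTheory

namespace LSW

/-- The standing assumptions on the coefficients `φ, ψ` of an LSW-like system on `[0,1]`.
Derivatives at `1` are one-sided: all derivatives are taken within `(0,1]`. -/
structure Coefficients (φ ψ : ℝ → ℝ) : Prop where
  cont_phi : ContinuousOn φ (Icc 0 1)
  cont_psi : ContinuousOn ψ (Icc 0 1)
  smooth_phi : ContDiffOn ℝ 2 φ (Ioc 0 1)
  smooth_psi : ContDiffOn ℝ 2 ψ (Ioc 0 1)
  concave_phi : ConcaveOn ℝ (Icc 0 1) φ
  phi_zero : φ 0 = 0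
  phi_one : φ 1 = 0
  deriv_phi_gt : -1 < derivWithin φ (Ioc 0 1) 1
  deriv_phi_lt : derivWithin φ (Ioc 0 1) 1 < 0
  convex_psi : ConvexOn ℝ (Icc 0 1) ψ
  psi_one : ψ 1 = 0
  deriv_psi_lt : derivWithin ψ (Ioc 0 1) 1 < 0
  second_deriv : 0 < iteratedDerivWithin 2 ψ (Ioc 0 1) 1 - iteratedDerivWithin 2 φ (Ioc 0 1) 1

/-- The additional assumption on the third derivatives of the coefficients:
`φ, ψ` are `C³` on `(0,1]`, with `φ''' ≥ 0` and `ψ''' ≤ 0` there. -/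
structure ThirdOrder (φ ψ : ℝ → ℝ) : Prop where
  smooth_phi : ContDiffOn ℝ 3 φ (Ioc 0 1)
  smooth_psi : ContDiffOn ℝ 3 ψ (Ioc 0 1)
  third_phi : ∀ x ∈ Ioc (0 : ℝ) 1, 0 ≤ iteratedDerivWithin 3 φ (Ioc 0 1) x
  third_psi : ∀ x ∈ Ioc (0 : ℝ) 1, iteratedDerivWithin 3 ψ (Ioc 0 1) x ≤ 0

/-- The tail integral `x ↦ ∫_x^1 f`. For a density `c`, this gives `w = tail c` and
`h = tail w`. -/
noncomputable def tail (f : ℝ → ℝ) (x : ℝ) : ℝ := ∫ y in x..1, f y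

/-- The beta function `β = c h / w²` of a density `c` on `[0,1)`. -/
noncomputable def beta (c : ℝ → ℝ) (x : ℝ) : ℝ := c x * tail (tail c) x / tail c x ^ 2

/-- Admissible initial densities: `c₀ ≥ 0` is integrable and `w₀ = tail c₀`
is strictly positive on `[0,1)` (so `w₀` is decreasing and tends to `0` at `1`). -/
structure InitialDensity (c₀ : ℝ → ℝ) : Prop where
  nonneg : ∀ x ∈ Ico (0 : ℝ) 1, 0 ≤ c₀ x
  integrable : IntervalIntegrable c₀ volume 0 1
  tail_pos : ∀ x ∈ Ico (0 : ℝ) 1, 0 < tail c₀ x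

/-- `X` is a characteristic curve on `[0,t]` of the transport field `φ - κ ψ`:
it takes its values in `[0,1)` and solves `X'(s) = φ(X(s)) - κ(s) ψ(X(s))`. -/
def IsCharacteristic (φ ψ κ : ℝ → ℝ) (t : ℝ) (X : ℝ → ℝ) : Prop :=
  ∀ s ∈ Icc 0 t, X s ∈ Ico (0 : ℝ) 1 ∧
    HasDerivWithinAt X (φ (X s) - κ s * ψ (X s)) (Icc 0 t) s

/-- `(w, κ)` (with `w x t` the value at `(x,t)`, `0 ≤ x < 1`, `t ≥ 0`) solves the LSW-like system
`∂w/∂t + [φ(x) - κ(t) ψ(x)] ∂w/∂x = w`, `∫₀¹ w(x,t) dx = 1`, with initial data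
`w(x,0) = ∫_x^1 c₀`.

As `c₀` need only be integrable, the partial derivatives of `w` need not exist at every point, and
the transport equation is understood along characteristics: every point `(x,t)` is the end point
of a characteristic curve `X` that starts at time `0`, and the derivative of `w` along it, which
is the left-hand side of the equation, satisfies `(d/ds) w(X(s),s) = w(X(s),s)`. Equivalently
`w(x,t) = e^t w₀(X(0))`. -/
structure IsSolution (φ ψ c₀ : ℝ → ℝ) (w : ℝ → ℝ → ℝ) (κ : ℝ → ℝ) : Prop where
  cont : ContinuousOn κ (Ici 0)
  initial : ∀ x ∈ Ico (0 : ℝ) 1, w x 0 = tail c₀ x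
  transport : ∀ t : ℝ, 0 ≤ t → ∀ x ∈ Ico (0 : ℝ) 1, ∃ X : ℝ → ℝ,
    IsCharacteristic φ ψ κ t X ∧ X t = x ∧
      ∀ s ∈ Icc 0 t, HasDerivWithinAt (fun r => w (X r) r) (w (X s) s) (Icc 0 t) s
  mass : ∀ t : ℝ, 0 ≤ t → ∫ x in (0 : ℝ)..1, w x t = 1

end LSW

/-!
Write `a = -φ'(1)`, `b = -ψ'(1)`, `w₀ = tail c₀`, `h₀ = tail w₀`, and
`w(x,t) = e^t w₀(F(x,t))`, where `F(x,t)` is the initial point of the characteristic that ends at `(x,t)`.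

*Initial data.* The quotient `h₀/w₀` has derivative `β - 1`, so that `h₀/((1-x) w₀)` tends to
`1 - β₀`. As `h₀' = -w₀`, this controls the logarithmic derivative of `h₀`, and `w₀` behaves like
the power `p = β₀/(1 - β₀)` of `1 - x`, up to arbitrarily small changes of the exponent
(`tendsto_log_tail_div`, `exists_log_tail_ge`).

*Characteristics.* The distance to `1` satisfies `(log (1 - X))' = κ ψ(X)/(1 - X) - φ(X)/(1 - X)`.
The first quotient is decreasing in `X` and the second is increasing, so relative distances to `1`
grow backwards in time, and the lower power law of `w₀` passes to `w(·,t)`. With `∫ w = 1` this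
confines `w(0,t)` to a fixed interval (`log_zero_le`). If `κ` were small over a short time, too
little mass would leave through `0` to balance the growth of `w`: this bounds `κ` from below
(`exists_kappa_ge`).

*Comparison with the linearized flow.* Since `w` grows like `e^s` along a characteristic and
dominates a power of `1 - x`, the distance of the characteristic to `1` is at most
`C e^{-(t-s)/q}`. The quotients `φ/(1-x)` and `ψ/(1-x)` differ from `a` and `b` by `O(1 - x)`, and
`∫ (1 + κ) (1 - X)` is bounded, so `log (1 - x) - log (1 - F(x,t))` equals `b ∫₀ᵗ κ - a t` up to a
bounded error, uniformly in `x` and `t` (`exists_linearExpansion_bound`).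

This has two consequences. The profile `w(·,t)` decreases by a fixed factor across the interval,
hence exceeds its mean near `0`, and a large `κ` over a short time would remove too much mass
(`exists_kappa_le`). And with `z = F(0,t)` the relations `log w₀(z) = -t + O(1)`,
`-log (1 - z) = b ∫₀ᵗ κ - a t + O(1)` and `log w₀(z) / log (1 - z) → p` give the limit `(1/p + a)/b`
of the time average of `κ` (`tendsto_average_kappa`).
-/

namespace LSW

/-! ### Chord quotients of the coefficients -/

/-- The chord quotient `f(x) / (1 - x)`: minus the slope of the chord of `f` from `x` to `1`,
for a function `f` that vanishes at `1`. -/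
noncomputable def chord (f : ℝ → ℝ) (x : ℝ) : ℝ := f x / (1 - x)

theorem chord_mul (f : ℝ → ℝ) {x : ℝ} (hx : x < 1) : chord f x * (1 - x) = f x :=
  div_mul_cancel₀ _ (by linarith)

theorem antitoneOn_chord {f : ℝ → ℝ} (hf : ConvexOn ℝ (Icc 0 1) f) (h1 : f 1 = 0) :
    AntitoneOn (chord f) (Ico 0 1) := by
  intro x hx y hy hxy
  have h := hf.secant_mono (a := 1) (by simp) (Ico_subset_Icc_self hx) (Ico_subset_Icc_self hy)
    hx.2.ne hy.2.ne hxy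
  rw [h1, sub_zero, sub_zero, ← neg_sub 1 x, ← neg_sub 1 y, div_neg, div_neg] at h
  exact neg_le_neg_iff.mp h

theorem tendsto_chord {f : ℝ → ℝ} (hf : ContDiffOn ℝ 2 f (Ioc 0 1)) (h1 : f 1 = 0) :
    Tendsto (chord f) (𝓝[<] 1) (𝓝 (-derivWithin f (Ioc 0 1) 1)) := by
  have hd : HasDerivWithinAt f (derivWithin f (Ioc 0 1) 1) (Ioc 0 1) 1 :=
    ((hf.differentiableOn (by norm_num)) 1 (by simp)).hasDerivWithinAt
  have h2 := (hasDerivWithinAt_iff_tendsto_slope' (by simp)).1 (hd.mono Ioo_subset_Ioc_self)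
  rw [nhdsWithin_Ioo_eq_nhdsLT one_pos] at h2
  refine h2.neg.congr fun x => ?_
  rw [slope_def_field, h1, sub_zero, chord, ← neg_sub 1 x, div_neg, neg_neg]

/-- Second-order Taylor expansion at `1`: the chord quotient approaches its limit
at a linear rate. -/
theorem abs_chord_sub_le_near {f : ℝ → ℝ} (hf : ContDiffOn ℝ 2 f (Ioc 0 1)) (h1 : f 1 = 0) :
    ∃ K : ℝ, ∀ᶠ x in 𝓝[<] (1 : ℝ),
      |chord f x + derivWithin f (Ioc 0 1) 1| ≤ K * (1 - x) := by
  have h := taylor_isLittleO (n := 2) (convex_Ioc (0 : ℝ) 1) (by simp : (1 : ℝ) ∈ Ioc (0 : ℝ) 1)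
    (by exact_mod_cast hf)
  have h' := h.mono (nhdsWithin_mono 1 (Ioo_subset_Ioc_self : Ioo (0 : ℝ) 1 ⊆ _))
  rw [nhdsWithin_Ioo_eq_nhdsLT one_pos] at h'
  have hb := h'.bound one_pos
  refine ⟨|iteratedDerivWithin 2 f (Ioc 0 1) 1| / 2 + 1, ?_⟩
  filter_upwards [hb, self_mem_nhdsWithin] with x hx hx1
  have hx1 : x < 1 := hx1
  set d := derivWithin f (Ioc 0 1) 1
  set e := iteratedDerivWithin 2 f (Ioc 0 1) 1 with he
  have hT : taylorWithinEval f 2 (Ioc 0 1) 1 x = (x - 1) * d + (x - 1) ^ 2 * e / 2 := by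
    rw [taylorWithinEval_succ, taylorWithinEval_succ, taylor_within_zero_eval, h1,
      iteratedDerivWithin_one]
    simp only [smul_eq_mul]
    norm_num [Nat.factorial]
    rw [← he]
    ring
  rw [hT, Real.norm_eq_abs, Real.norm_eq_abs, one_mul, abs_of_nonneg (sq_nonneg (x - 1))] at hx
  have h1x : 0 < 1 - x := by linarith
  have hc := chord_mul f hx1
  have hA : |chord f x + d| * (1 - x) ≤ ((|e| / 2 + 1) * (1 - x)) * (1 - x) := by
    have hsplit : (chord f x + d) * (1 - x) =
        (f x - ((x - 1) * d + (x - 1) ^ 2 * e / 2)) + (x - 1) ^ 2 * (e / 2) := by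
      rw [← hc]; ring
    calc |chord f x + d| * (1 - x) = |(chord f x + d) * (1 - x)| := by
          rw [abs_mul, abs_of_pos h1x]
      _ ≤ (x - 1) ^ 2 + (x - 1) ^ 2 * (|e| / 2) := by
          rw [hsplit]
          refine (abs_add_le _ _).trans (add_le_add hx ?_)
          rw [abs_mul, abs_of_nonneg (sq_nonneg (x - 1)), abs_div, abs_two]
      _ = _ := by ring
  exact le_of_mul_le_mul_right hA h1x

namespace Coefficients

variable {φ ψ : ℝ → ℝ}

theorem monotoneOn_chord_phi (h : Coefficients φ ψ) : MonotoneOn (chord φ) (Ico 0 1) := by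
  have hn := antitoneOn_chord h.concave_phi.neg (by simp [h.phi_one])
  intro x hx y hy hxy
  have := hn hx hy hxy
  simp only [chord, Pi.neg_apply, neg_div] at this
  exact neg_le_neg_iff.mp this

theorem antitoneOn_chord_psi (h : Coefficients φ ψ) : AntitoneOn (chord ψ) (Ico 0 1) :=
  antitoneOn_chord h.convex_psi h.psi_one

theorem chord_phi_nonneg (h : Coefficients φ ψ) {x : ℝ} (hx : x ∈ Ico (0 : ℝ) 1) :
    0 ≤ chord φ x := by
  have := h.monotoneOn_chord_phi (by simp) hx hx.1
  simpa [chord, h.phi_zero] using this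

theorem chord_phi_le (h : Coefficients φ ψ) {x : ℝ} (hx : x ∈ Ico (0 : ℝ) 1) :
    chord φ x ≤ -derivWithin φ (Ioc 0 1) 1 := by
  refine ge_of_tendsto (tendsto_chord h.smooth_phi h.phi_one) ?_
  filter_upwards [Ioo_mem_nhdsLT hx.2] with y hy
  exact h.monotoneOn_chord_phi hx ⟨hx.1.trans hy.1.le, hy.2⟩ hy.1.le

theorem le_chord_psi (h : Coefficients φ ψ) {x : ℝ} (hx : x ∈ Ico (0 : ℝ) 1) :
    -derivWithin ψ (Ioc 0 1) 1 ≤ chord ψ x := by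
  refine le_of_tendsto (tendsto_chord h.smooth_psi h.psi_one) ?_
  filter_upwards [Ioo_mem_nhdsLT hx.2] with y hy
  exact h.antitoneOn_chord_psi hx ⟨hx.1.trans hy.1.le, hy.2⟩ hy.1.le

theorem chord_psi_le (h : Coefficients φ ψ) {x : ℝ} (hx : x ∈ Ico (0 : ℝ) 1) :
    chord ψ x ≤ ψ 0 := by
  simpa [chord] using h.antitoneOn_chord_psi (by simp) hx hx.1

theorem psi_zero_pos (h : Coefficients φ ψ) : 0 < ψ 0 := by
  have h1 := h.le_chord_psi (x := 0) (by simp)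
  have h2 := h.chord_psi_le (x := 0) (by simp)
  linarith [h.deriv_psi_lt]

theorem phi_nonneg (h : Coefficients φ ψ) {x : ℝ} (hx : x ∈ Ico (0 : ℝ) 1) : 0 ≤ φ x := by
  rw [← chord_mul φ hx.2]
  exact mul_nonneg (h.chord_phi_nonneg hx) (by linarith [hx.2])

theorem psi_nonneg (h : Coefficients φ ψ) {x : ℝ} (hx : x ∈ Ico (0 : ℝ) 1) : 0 ≤ ψ x := by
  rw [← chord_mul ψ hx.2]
  exact mul_nonneg (by linarith [h.le_chord_psi hx, h.deriv_psi_lt]) (by linarith [hx.2])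

theorem psi_le (h : Coefficients φ ψ) {x : ℝ} (hx : x ∈ Ico (0 : ℝ) 1) : ψ x ≤ ψ 0 := by
  rw [← chord_mul ψ hx.2]
  nlinarith [h.chord_psi_le hx, h.psi_zero_pos, hx.1, hx.2]

/-- By concavity, `φ` never decreases faster than at `1`. -/
theorem phi_sub_ge (h : Coefficients φ ψ) {x y : ℝ} (hx : x ∈ Ico (0 : ℝ) 1)
    (hy : y ∈ Ico (0 : ℝ) 1) (hxy : x < y) :
    derivWithin φ (Ioc 0 1) 1 * (y - x) ≤ φ y - φ x := by
  have h1 := h.concave_phi.slope_anti_adjacent (Ico_subset_Icc_self hx)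
    (by simp : (1 : ℝ) ∈ Icc (0 : ℝ) 1) hxy hy.2
  have h2 := h.chord_phi_le hy
  rw [h.phi_one, zero_sub, neg_div] at h1
  rw [chord] at h2
  rw [← le_div_iff₀ (by linarith)]
  linarith

theorem psi_antitoneOn (h : Coefficients φ ψ) : AntitoneOn ψ (Ico 0 1) := by
  intro x hx y hy hxy
  rw [← chord_mul ψ hx.2, ← chord_mul ψ hy.2]
  have hp : 0 ≤ chord ψ y := by linarith [h.le_chord_psi hy, h.deriv_psi_lt]
  exact mul_le_mul (h.antitoneOn_chord_psi hx hy hxy) (by linarith) (by linarith [hy.2])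
    (hp.trans (h.antitoneOn_chord_psi hx hy hxy))

/-- The chord quotients of `φ` and `ψ` approach their limits at `1` at a linear rate, uniformly
on `[0,1)`: near `1` by Taylor's formula, and elsewhere because they are bounded. -/
theorem exists_chord_rate (h : Coefficients φ ψ) :
    ∃ L : ℝ, 0 < L ∧ ∀ x ∈ Ico (0 : ℝ) 1,
      -derivWithin φ (Ioc 0 1) 1 - chord φ x ≤ L * (1 - x) ∧
      chord ψ x + derivWithin ψ (Ioc 0 1) 1 ≤ L * (1 - x) := by
  obtain ⟨K₁, hK₁⟩ := abs_chord_sub_le_near h.smooth_phi h.phi_one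
  obtain ⟨K₂, hK₂⟩ := abs_chord_sub_le_near h.smooth_psi h.psi_one
  obtain ⟨z, hz, hzs⟩ := (mem_nhdsLT_iff_exists_Ioo_subset).1 (hK₁.and hK₂)
  have hz : z < 1 := hz
  have hψ0 := h.psi_zero_pos
  set a := -derivWithin φ (Ioc 0 1) 1 with ha
  have hd : 0 < a := by linarith [h.deriv_phi_lt]
  have hM : 0 ≤ (a + ψ 0) / (1 - z) := div_nonneg (by linarith) (by linarith)
  refine ⟨|K₁| + |K₂| + (a + ψ 0) / (1 - z) + 1, by positivity, fun x hx => ?_⟩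
  have h1x : 0 < 1 - x := by linarith [hx.2]
  rcases lt_or_ge z x with hzx | hzx
  · obtain ⟨h1, h2⟩ := hzs ⟨hzx, hx.2⟩
    have e1 := mul_le_mul_of_nonneg_right (le_abs_self K₁) h1x.le
    have e2 := mul_le_mul_of_nonneg_right (le_abs_self K₂) h1x.le
    have e3 := mul_nonneg (abs_nonneg K₁) h1x.le
    have e4 := mul_nonneg (abs_nonneg K₂) h1x.le
    have e5 := mul_nonneg hM h1x.le
    constructor
    · have := (neg_abs_le _).trans' (neg_le_neg h1)
      linarith
    · have := (le_abs_self _).trans h2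
      linarith
  · have e5 : a + ψ 0 ≤ (a + ψ 0) / (1 - z) * (1 - x) := by
      rw [div_mul_eq_mul_div, le_div_iff₀ (by linarith)]
      exact mul_le_mul_of_nonneg_left (by linarith) (by linarith)
    have e3 := mul_nonneg (abs_nonneg K₁) h1x.le
    have e4 := mul_nonneg (abs_nonneg K₂) h1x.le
    have := h.chord_phi_nonneg hx
    have := h.chord_psi_le hx
    have := h.deriv_psi_lt
    constructor <;> linarith

end Coefficients

/-! ### Tail integrals of the initial density -/

theorem tail_one (f : ℝ → ℝ) : tail f 1 = 0 := intervalIntegral.integral_same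

theorem tendsto_one_sub_log : Tendsto (fun z : ℝ => Real.log (1 - z)) (𝓝[<] 1) atBot := by
  refine Real.tendsto_log_nhdsGT_zero.comp (tendsto_nhdsWithin_iff.2 ⟨?_, ?_⟩)
  · have : Tendsto (fun z : ℝ => 1 - z) (𝓝 1) (𝓝 (1 - 1)) := Continuous.tendsto (by fun_prop) 1
    rw [sub_self] at this
    exact tendsto_nhdsWithin_of_tendsto_nhds this
  · filter_upwards [self_mem_nhdsWithin] with z hz
    exact sub_pos.2 (mem_Iio.1 hz)

/-- The tail of `c₀` obeys a lower power-law bound `w₀(y) / w₀(x) ≥ e^{-M} ((1 - y) / (1 - x))^q`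
for `x ≤ y`, in logarithmic form. -/
def TailLowerBound (c₀ : ℝ → ℝ) (M q : ℝ) : Prop :=
  ∀ x ∈ Ico (0 : ℝ) 1, ∀ y ∈ Ico x 1,
    Real.log (tail c₀ x) + q * (Real.log (1 - y) - Real.log (1 - x)) - M ≤ Real.log (tail c₀ y)

namespace InitialDensity

variable {c₀ : ℝ → ℝ}

theorem intervalIntegrable_of_mem (h : InitialDensity c₀) {x y : ℝ} (hx : x ∈ Icc (0 : ℝ) 1)
    (hy : y ∈ Icc (0 : ℝ) 1) : IntervalIntegrable c₀ volume x y :=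
  h.integrable.mono_set (by rw [uIcc_of_le zero_le_one]; exact uIcc_subset_Icc hx hy)

theorem tail_sub (h : InitialDensity c₀) {x y : ℝ} (hx : x ∈ Icc (0 : ℝ) 1)
    (hy : y ∈ Icc (0 : ℝ) 1) : tail c₀ x - tail c₀ y = ∫ s in x..y, c₀ s := by
  rw [tail, tail, sub_eq_iff_eq_add]
  exact (intervalIntegral.integral_add_adjacent_intervals (h.intervalIntegrable_of_mem hx hy)
    (h.intervalIntegrable_of_mem hy (by simp))).symm

theorem tail_antitoneOn (h : InitialDensity c₀) : AntitoneOn (tail c₀) (Icc 0 1) := by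
  intro x hx y hy hxy
  rw [← sub_nonneg, h.tail_sub hx hy]
  have := intervalIntegral.integral_mono_on_of_le_Ioo (f := fun _ => 0) hxy
    intervalIntegrable_const (h.intervalIntegrable_of_mem hx hy)
    (fun s hs => h.nonneg s ⟨hx.1.trans hs.1.le, hs.2.trans_le hy.2⟩)
  simpa using this

theorem tail_continuousOn (h : InitialDensity c₀) : ContinuousOn (tail c₀) (Icc 0 1) := by
  have := intervalIntegral.continuousOn_primitive_interval_left (a := 0) (b := 1) (μ := volume)
    (f := c₀) (by
      rw [uIcc_of_le zero_le_one]
      exact (intervalIntegrable_iff_integrableOn_Icc_of_le zero_le_one).1 h.integrable)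
  rwa [uIcc_of_le zero_le_one] at this

theorem tail_intervalIntegrable (h : InitialDensity c₀) {x y : ℝ} (hx : x ∈ Icc (0 : ℝ) 1)
    (hy : y ∈ Icc (0 : ℝ) 1) : IntervalIntegrable (tail c₀) volume x y :=
  (h.tail_continuousOn.mono (uIcc_subset_Icc hx hy)).intervalIntegrable

theorem tail_tail_sub (h : InitialDensity c₀) {x y : ℝ} (hx : x ∈ Icc (0 : ℝ) 1)
    (hy : y ∈ Icc (0 : ℝ) 1) :
    tail (tail c₀) x - tail (tail c₀) y = ∫ s in x..y, tail c₀ s := by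
  rw [tail, tail, sub_eq_iff_eq_add]
  exact (intervalIntegral.integral_add_adjacent_intervals (h.tail_intervalIntegrable hx hy)
    (h.tail_intervalIntegrable hy (by simp))).symm

theorem tail_tail_sub_le (h : InitialDensity c₀) {x y : ℝ} (hx : x ∈ Icc (0 : ℝ) 1)
    (hy : y ∈ Icc (0 : ℝ) 1) (hxy : x ≤ y) :
    tail (tail c₀) x - tail (tail c₀) y ≤ (y - x) * tail c₀ x := by
  rw [h.tail_tail_sub hx hy]
  have := intervalIntegral.integral_mono_on hxy (h.tail_intervalIntegrable hx hy)
    (intervalIntegrable_const (c := tail c₀ x))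
    (fun s hs => h.tail_antitoneOn hx ⟨hx.1.trans hs.1, hs.2.trans hy.2⟩ hs.1)
  simpa using this

theorem le_tail_tail_sub (h : InitialDensity c₀) {x y : ℝ} (hx : x ∈ Icc (0 : ℝ) 1)
    (hy : y ∈ Icc (0 : ℝ) 1) (hxy : x ≤ y) :
    (y - x) * tail c₀ y ≤ tail (tail c₀) x - tail (tail c₀) y := by
  rw [h.tail_tail_sub hx hy]
  have := intervalIntegral.integral_mono_on hxy (intervalIntegrable_const (c := tail c₀ y))
    (h.tail_intervalIntegrable hx hy)
    (fun s hs => h.tail_antitoneOn ⟨hx.1.trans hs.1, hs.2.trans hy.2⟩ hy hs.2)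
  simpa using this

theorem tail_tail_le (h : InitialDensity c₀) {x : ℝ} (hx : x ∈ Icc (0 : ℝ) 1) :
    tail (tail c₀) x ≤ (1 - x) * tail c₀ x := by
  simpa [tail_one] using h.tail_tail_sub_le hx (by simp : (1 : ℝ) ∈ Icc (0 : ℝ) 1) hx.2

theorem tail_tail_pos (h : InitialDensity c₀) {x : ℝ} (hx : x ∈ Ico (0 : ℝ) 1) :
    0 < tail (tail c₀) x :=
  intervalIntegral.intervalIntegral_pos_of_pos_on
    (h.tail_intervalIntegrable (Ico_subset_Icc_self hx) (by simp))
    (fun s hs => h.tail_pos s ⟨hx.1.trans hs.1.le, hs.2⟩) hx.2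

theorem tail_nonneg (h : InitialDensity c₀) {x : ℝ} (hx : x ∈ Icc (0 : ℝ) 1) :
    0 ≤ tail c₀ x := by
  simpa [tail_one] using h.tail_antitoneOn hx (by simp : (1 : ℝ) ∈ Icc (0 : ℝ) 1) hx.2

theorem tail_tail_antitoneOn (h : InitialDensity c₀) :
    AntitoneOn (tail (tail c₀)) (Icc 0 1) := fun x hx y hy hxy => by
  have := h.le_tail_tail_sub hx hy hxy
  have := mul_nonneg (sub_nonneg.2 hxy) (h.tail_nonneg hy)
  linarith

theorem tail_tail_hasDerivAt (h : InitialDensity c₀) {x : ℝ} (hx : x ∈ Ioo (0 : ℝ) 1) :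
    HasDerivAt (tail (tail c₀)) (-tail c₀ x) x := by
  refine intervalIntegral.integral_hasDerivAt_left
    (h.tail_intervalIntegrable (Ioo_subset_Icc_self hx) (by simp)) ?_ ?_
  · exact ContinuousOn.stronglyMeasurableAtFilter isOpen_Ioo
      (h.tail_continuousOn.mono Ioo_subset_Icc_self) x hx
  · exact h.tail_continuousOn.continuousAt (Icc_mem_nhds hx.1 hx.2)

theorem tail_tail_continuousOn (h : InitialDensity c₀) :
    ContinuousOn (tail (tail c₀)) (Icc 0 1) := by
  have := intervalIntegral.continuousOn_primitive_interval_left (a := 0) (b := 1) (μ := volume)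
    (f := tail c₀) (by
      rw [uIcc_of_le zero_le_one]
      exact (intervalIntegrable_iff_integrableOn_Icc_of_le zero_le_one).1
        (h.tail_intervalIntegrable (by simp) (by simp)))
  rwa [uIcc_of_le zero_le_one] at this

theorem quotient_continuousOn (h : InitialDensity c₀) {x y : ℝ} (hx : 0 ≤ x) (hy : y < 1) :
    ContinuousOn (fun z => tail (tail c₀) z / tail c₀ z) (Icc x y) := by
  have hs : Icc x y ⊆ Icc 0 1 := Icc_subset_Icc hx hy.le
  exact (h.tail_tail_continuousOn.mono hs).div (h.tail_continuousOn.mono hs)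
    fun z hz => (h.tail_pos z ⟨hx.trans hz.1, hz.2.trans_lt hy⟩).ne'

/-! ### From the beta function to the tail integrals -/

/-- If `β ≤ γ` to the right of `x`, then `h/w` decreases at least at the rate `1 - γ`, because
`(h/w)' = β - 1` almost everywhere, and it vanishes at `1`. As `w` is only absolutely continuous,
the differential inequality is used in the form of a bound on difference quotients. -/
theorem tail_tail_ge_of_beta_le (h : InitialDensity c₀) {γ x : ℝ} (hγ : 0 ≤ γ)
    (hx : x ∈ Ico (0 : ℝ) 1) (hβ : ∀ s ∈ Ioo x 1, beta c₀ s ≤ γ) :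
    (1 - γ) * (1 - x) * tail c₀ x ≤ tail (tail c₀) x := by
  set W := tail c₀ with hW
  set H := tail W with hH
  have key : ∀ y ∈ Ico x 1, H y / W y ≤ H x / W x + (γ - 1) * (y - x) := by
    intro y hy
    have hB : ∀ u : ℝ, HasDerivAt (fun u => H x / W x + (γ - 1) * (u - x)) (γ - 1) u := by
      intro u
      simpa using (((hasDerivAt_id u).sub_const x).const_mul (γ - 1)).const_add (H x / W x)
    refine image_le_of_liminf_slope_right_le_deriv_boundary (f := fun z => H z / W z)
      (a := x) (b := y) (h.quotient_continuousOn hx.1 hy.2) (by simp)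
      (fun u _ => (hB u).continuousAt.continuousWithinAt)
      (fun u _ => (hB u).hasDerivWithinAt) ?_ (right_mem_Icc.2 hy.1)
    intro u hu r hr
    have hu0 : u ∈ Ico (0 : ℝ) 1 := ⟨hx.1.trans hu.1, hu.2.trans hy.2⟩
    have hui : Icc 0 1 ∈ 𝓝[>] u :=
      mem_of_superset (Ioo_mem_nhdsGT hu0.2) fun z hz => ⟨hu0.1.trans hz.1.le, hz.2.le⟩
    have hWc : Tendsto W (𝓝[>] u) (𝓝 (W u)) :=
      ((h.tail_continuousOn u (Ico_subset_Icc_self hu0)).mono_of_mem_nhdsWithin hui)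
    have hHc : Tendsto H (𝓝[>] u) (𝓝 (H u)) :=
      ((h.tail_tail_continuousOn u (Ico_subset_Icc_self hu0)).mono_of_mem_nhdsWithin hui)
    have hWu : 0 < W u := h.tail_pos u hu0
    have hHu : 0 < H u := h.tail_tail_pos hu0
    have hlim : Tendsto (fun z => γ * (H u * W u) / (H z * W z) - 1) (𝓝[>] u) (𝓝 (γ - 1)) := by
      have := ((tendsto_const_nhds (x := γ * (H u * W u))).div (hHc.mul hWc)
        (mul_pos hHu hWu).ne').sub_const 1
      rwa [mul_div_assoc, div_self (mul_pos hHu hWu).ne', mul_one] at this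
    refine Eventually.frequently ?_
    filter_upwards [hlim.eventually_lt_const hr, Ioo_mem_nhdsGT hu0.2] with z hz hz1
    refine lt_of_le_of_lt ?_ hz
    have hz0 : z ∈ Ico (0 : ℝ) 1 := ⟨hu0.1.trans hz1.1.le, hz1.2⟩
    have hWz : 0 < W z := h.tail_pos z hz0
    have hHz : 0 < H z := h.tail_tail_pos hz0
    have hzu : 0 < z - u := sub_pos.2 hz1.1
    have hc : W u - W z ≤ (z - u) * (γ * W u ^ 2 / H z) := by
      rw [h.tail_sub (Ico_subset_Icc_self hu0) (Ico_subset_Icc_self hz0)]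
      have := intervalIntegral.integral_mono_on_of_le_Ioo hz1.1.le
        (h.intervalIntegrable_of_mem (Ico_subset_Icc_self hu0) (Ico_subset_Icc_self hz0))
        (intervalIntegrable_const (c := γ * W u ^ 2 / H z)) (fun s hs => ?_)
      · simpa only [intervalIntegral.integral_const, smul_eq_mul] using this
      · have hs0 : s ∈ Ico (0 : ℝ) 1 := ⟨hu0.1.trans hs.1.le, hs.2.trans hz1.2⟩
        have hWs : 0 < W s := h.tail_pos s hs0
        have hHs : 0 < H s := h.tail_tail_pos hs0
        have hb := hβ s ⟨hu.1.trans_lt hs.1, hs0.2⟩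
        rw [beta, div_le_iff₀ (by positivity)] at hb
        have hsu : W s ≤ W u :=
          h.tail_antitoneOn (Ico_subset_Icc_self hu0) (Ico_subset_Icc_self hs0) hs.1.le
        have hsz : H z ≤ H s :=
          h.tail_tail_antitoneOn (Ico_subset_Icc_self hs0) (Ico_subset_Icc_self hz0) hs.2.le
        rw [le_div_iff₀ hHz]
        calc c₀ s * H z ≤ c₀ s * H s := mul_le_mul_of_nonneg_left hsz (h.nonneg s hs0)
          _ ≤ γ * W s ^ 2 := hb
          _ ≤ γ * W u ^ 2 := by gcongr
    have hHs : (z - u) * W z ≤ H u - H z :=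
      h.le_tail_tail_sub (Ico_subset_Icc_self hu0) (Ico_subset_Icc_self hz0) hz1.1.le
    rw [slope_def_field, div_le_iff₀ hzu]
    have e1 : H z / W z - H u / W u =
        H u / (W u * W z) * (W u - W z) - (H u - H z) / W z := by
      field_simp
      ring
    have e2 : H u / (W u * W z) * (W u - W z) ≤
        H u / (W u * W z) * ((z - u) * (γ * W u ^ 2 / H z)) :=
      mul_le_mul_of_nonneg_left hc (by positivity)
    have e3 : z - u ≤ (H u - H z) / W z := by rwa [le_div_iff₀ hWz]
    have e4 : H u / (W u * W z) * ((z - u) * (γ * W u ^ 2 / H z)) =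
        γ * (H u * W u) / (H z * W z) * (z - u) := by
      field_simp
    rw [e1]
    linarith
  have hWx : 0 < W x := h.tail_pos x hx
  have hlim : Tendsto (fun y => H x / W x + (γ - 1) * (y - x)) (𝓝[<] 1)
      (𝓝 (H x / W x + (γ - 1) * (1 - x))) :=
    tendsto_nhdsWithin_of_tendsto_nhds (Continuous.tendsto (by fun_prop) 1)
  have h0 : 0 ≤ H x / W x + (γ - 1) * (1 - x) := by
    refine ge_of_tendsto hlim ?_
    filter_upwards [Ioo_mem_nhdsLT hx.2] with y hy
    refine le_trans ?_ (key y ⟨hy.1.le, hy.2⟩)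
    have hy0 : y ∈ Ico (0 : ℝ) 1 := ⟨hx.1.trans hy.1.le, hy.2⟩
    exact div_nonneg (h.tail_tail_pos hy0).le (h.tail_pos y hy0).le
  rw [← le_div_iff₀ hWx]
  linarith

/-- The counterpart of `tail_tail_ge_of_beta_le` for a lower bound on `β`. -/
theorem tail_tail_le_of_le_beta (h : InitialDensity c₀) {γ x : ℝ} (hγ : 0 ≤ γ)
    (hx : x ∈ Ico (0 : ℝ) 1) (hβ : ∀ s ∈ Ioo x 1, γ ≤ beta c₀ s) :
    tail (tail c₀) x ≤ (1 - γ) * (1 - x) * tail c₀ x := by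
  set W := tail c₀ with hW
  set H := tail W with hH
  have key : ∀ y ∈ Ico x 1, -(H y / W y) ≤ -(H x / W x) + (1 - γ) * (y - x) := by
    intro y hy
    have hB : ∀ u : ℝ, HasDerivAt (fun u => -(H x / W x) + (1 - γ) * (u - x)) (1 - γ) u := by
      intro u
      simpa using (((hasDerivAt_id u).sub_const x).const_mul (1 - γ)).const_add (-(H x / W x))
    refine image_le_of_liminf_slope_right_le_deriv_boundary (f := fun z => -(H z / W z))
      (a := x) (b := y) (h.quotient_continuousOn hx.1 hy.2).neg (by simp)
      (fun u _ => (hB u).continuousAt.continuousWithinAt)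
      (fun u _ => (hB u).hasDerivWithinAt) ?_ (right_mem_Icc.2 hy.1)
    intro u hu r hr
    have hu0 : u ∈ Ico (0 : ℝ) 1 := ⟨hx.1.trans hu.1, hu.2.trans hy.2⟩
    have hui : Icc 0 1 ∈ 𝓝[>] u :=
      mem_of_superset (Ioo_mem_nhdsGT hu0.2) fun z hz => ⟨hu0.1.trans hz.1.le, hz.2.le⟩
    have hWc : Tendsto W (𝓝[>] u) (𝓝 (W u)) :=
      ((h.tail_continuousOn u (Ico_subset_Icc_self hu0)).mono_of_mem_nhdsWithin hui)
    have hWu : 0 < W u := h.tail_pos u hu0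
    have hHu : 0 < H u := h.tail_tail_pos hu0
    have hlim : Tendsto (fun z => W u / W z - γ * (W z / W u)) (𝓝[>] u) (𝓝 (1 - γ)) := by
      have := ((tendsto_const_nhds (x := W u)).div hWc hWu.ne').sub
        ((hWc.div_const (W u)).const_mul γ)
      rwa [div_self hWu.ne', mul_one] at this
    refine Eventually.frequently ?_
    filter_upwards [hlim.eventually_lt_const hr, Ioo_mem_nhdsGT hu0.2] with z hz hz1
    refine lt_of_le_of_lt ?_ hz
    have hz0 : z ∈ Ico (0 : ℝ) 1 := ⟨hu0.1.trans hz1.1.le, hz1.2⟩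
    have hWz : 0 < W z := h.tail_pos z hz0
    have hzu : 0 < z - u := sub_pos.2 hz1.1
    have hc : (z - u) * (γ * W z ^ 2 / H u) ≤ W u - W z := by
      rw [h.tail_sub (Ico_subset_Icc_self hu0) (Ico_subset_Icc_self hz0)]
      have := intervalIntegral.integral_mono_on_of_le_Ioo hz1.1.le
        (intervalIntegrable_const (c := γ * W z ^ 2 / H u))
        (h.intervalIntegrable_of_mem (Ico_subset_Icc_self hu0) (Ico_subset_Icc_self hz0))
        (fun s hs => ?_)
      · simpa only [intervalIntegral.integral_const, smul_eq_mul] using this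
      · have hs0 : s ∈ Ico (0 : ℝ) 1 := ⟨hu0.1.trans hs.1.le, hs.2.trans hz1.2⟩
        have hWs : 0 < W s := h.tail_pos s hs0
        have hb := hβ s ⟨hu.1.trans_lt hs.1, hs0.2⟩
        rw [beta, le_div_iff₀ (by positivity)] at hb
        have hsz : W z ≤ W s :=
          h.tail_antitoneOn (Ico_subset_Icc_self hs0) (Ico_subset_Icc_self hz0) hs.2.le
        have hsu : H s ≤ H u :=
          h.tail_tail_antitoneOn (Ico_subset_Icc_self hu0) (Ico_subset_Icc_self hs0) hs.1.le
        rw [div_le_iff₀ hHu]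
        calc γ * W z ^ 2 ≤ γ * W s ^ 2 := by gcongr
          _ ≤ c₀ s * H s := hb
          _ ≤ c₀ s * H u := mul_le_mul_of_nonneg_left hsu (h.nonneg s hs0)
    have hHs : H u - H z ≤ (z - u) * W u :=
      h.tail_tail_sub_le (Ico_subset_Icc_self hu0) (Ico_subset_Icc_self hz0) hz1.1.le
    rw [slope_def_field, div_le_iff₀ hzu]
    have e1 : -(H z / W z) - -(H u / W u) =
        (H u - H z) / W z - H u / (W u * W z) * (W u - W z) := by
      field_simp
      ring
    have e2 : H u / (W u * W z) * ((z - u) * (γ * W z ^ 2 / H u)) ≤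
        H u / (W u * W z) * (W u - W z) :=
      mul_le_mul_of_nonneg_left hc (by positivity)
    have e3 : (H u - H z) / W z ≤ (z - u) * W u / W z := by gcongr
    have e4 : H u / (W u * W z) * ((z - u) * (γ * W z ^ 2 / H u)) =
        γ * (W z / W u) * (z - u) := by
      field_simp
    have e5 : (z - u) * W u / W z = W u / W z * (z - u) := by ring
    rw [e1]
    linarith
  have hWx : 0 < W x := h.tail_pos x hx
  have hlim : Tendsto (fun y => (1 - y) + (1 - γ) * (y - x)) (𝓝[<] 1)
      (𝓝 ((1 - 1) + (1 - γ) * (1 - x))) :=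
    tendsto_nhdsWithin_of_tendsto_nhds (Continuous.tendsto (by fun_prop) 1)
  have h0 : H x / W x ≤ (1 - 1) + (1 - γ) * (1 - x) := by
    refine ge_of_tendsto hlim ?_
    filter_upwards [Ioo_mem_nhdsLT hx.2] with y hy
    have hy0 : y ∈ Ico (0 : ℝ) 1 := ⟨hx.1.trans hy.1.le, hy.2⟩
    have h1 := key y ⟨hy.1.le, hy.2⟩
    have h2 : H y / W y ≤ 1 - y := by
      rw [div_le_iff₀ (h.tail_pos y hy0)]
      exact h.tail_tail_le (Ico_subset_Icc_self hy0)
    linarith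
  rw [← div_le_iff₀ hWx]
  linarith

theorem eventually_le_tail_tail (h : InitialDensity c₀) {β₀ μ : ℝ} (hβ₀ : 0 < β₀)
    (hβ : Tendsto (beta c₀) (𝓝[<] 1) (𝓝 β₀)) (hμ : μ < 1 - β₀) :
    ∃ z ∈ Ico (0 : ℝ) 1, ∀ x ∈ Ico z 1, μ * (1 - x) * tail c₀ x ≤ tail (tail c₀) x := by
  obtain ⟨z, hz, hzs⟩ := (mem_nhdsLT_iff_exists_Ioo_subset).1
    (hβ.eventually_lt_const (show β₀ < 1 - μ by linarith))
  refine ⟨max z 0, ⟨le_max_right _ _, max_lt hz one_pos⟩, fun x hx => ?_⟩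
  have := h.tail_tail_ge_of_beta_le (γ := 1 - μ) (by linarith)
    ⟨(le_max_right _ _).trans hx.1, hx.2⟩
    (fun s hs => (hzs ⟨((le_max_left _ _).trans hx.1).trans_lt hs.1, hs.2⟩).le)
  simpa using this

theorem eventually_tail_tail_le (h : InitialDensity c₀) {β₀ ν : ℝ}
    (hβ : Tendsto (beta c₀) (𝓝[<] 1) (𝓝 β₀)) (hν : 1 - β₀ < ν) (hν1 : ν < 1) :
    ∃ z ∈ Ico (0 : ℝ) 1, ∀ x ∈ Ico z 1, tail (tail c₀) x ≤ ν * (1 - x) * tail c₀ x := by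
  obtain ⟨z, hz, hzs⟩ := (mem_nhdsLT_iff_exists_Ioo_subset).1
    (hβ.eventually_const_lt (show 1 - ν < β₀ by linarith))
  refine ⟨max z 0, ⟨le_max_right _ _, max_lt hz one_pos⟩, fun x hx => ?_⟩
  have := h.tail_tail_le_of_le_beta (γ := 1 - ν) (by linarith)
    ⟨(le_max_right _ _).trans hx.1, hx.2⟩
    (fun s hs => (hzs ⟨((le_max_left _ _).trans hx.1).trans_lt hs.1, hs.2⟩).le)
  simpa using this

/-! ### Power-law bounds for the tail of the initial density -/

/-- Near `1` this follows from `β₀ < 1`, and elsewhere `h₀` is bounded below. -/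
theorem exists_le_tail_tail (h : InitialDensity c₀) {β₀ : ℝ} (hβ₀ : 0 < β₀) (hβ₁ : β₀ < 1)
    (hβ : Tendsto (beta c₀) (𝓝[<] 1) (𝓝 β₀)) :
    ∃ m : ℝ, 0 < m ∧ ∀ x ∈ Ico (0 : ℝ) 1, m * (1 - x) * tail c₀ x ≤ tail (tail c₀) x := by
  obtain ⟨z, hz, hzs⟩ := h.eventually_le_tail_tail hβ₀ hβ
    (show (1 - β₀) / 2 < 1 - β₀ by linarith)
  have hW0 := h.tail_pos 0 (by simp)
  have hHz := h.tail_tail_pos hz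
  set W := tail c₀
  set H := tail W
  refine ⟨min ((1 - β₀) / 2) (H z / W 0), lt_min (by linarith) (div_pos hHz hW0),
    fun x hx => ?_⟩
  have hWx := h.tail_pos x hx
  have h1x : 0 < 1 - x := sub_pos.2 hx.2
  rcases le_total z x with hzx | hzx
  · refine le_trans ?_ (hzs x ⟨hzx, hx.2⟩)
    gcongr
    exact min_le_left _ _
  · have h1 : H z ≤ H x :=
      h.tail_tail_antitoneOn (Ico_subset_Icc_self hx) (Ico_subset_Icc_self hz) hzx
    have h2 : W x ≤ W 0 := h.tail_antitoneOn (by simp) (Ico_subset_Icc_self hx) hx.1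
    calc min ((1 - β₀) / 2) (H z / W 0) * (1 - x) * W x
        ≤ H z / W 0 * 1 * W 0 := by
          gcongr
          · exact min_le_right _ _
          · linarith [hx.1]
      _ = H z := by field_simp
      _ ≤ H x := h1

theorem log_sub_hasDerivAt (h : InitialDensity c₀) (q : ℝ) {x : ℝ} (hx : x ∈ Ioo (0 : ℝ) 1) :
    HasDerivAt (fun z => Real.log (tail (tail c₀) z) - q * Real.log (1 - z))
      (-tail c₀ x / tail (tail c₀) x - q * (-1 / (1 - x))) x := by
  have hx0 : x ∈ Ico (0 : ℝ) 1 := ⟨hx.1.le, hx.2⟩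
  have h1 := (h.tail_tail_hasDerivAt hx).log (h.tail_tail_pos hx0).ne'
  have h2 := (((hasDerivAt_id x).const_sub 1).log (by simpa using (sub_pos.2 hx.2).ne')).const_mul q
  exact h1.sub h2

theorem log_sub_continuousOn (h : InitialDensity c₀) (q : ℝ) {z : ℝ} (hz : 0 ≤ z) :
    ContinuousOn (fun z => Real.log (tail (tail c₀) z) - q * Real.log (1 - z)) (Ico z 1) := by
  refine ContinuousOn.sub (ContinuousOn.log (h.tail_tail_continuousOn.mono ?_) ?_)
    (continuousOn_const.mul (ContinuousOn.log (by fun_prop) ?_))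
  · exact fun x hx => ⟨hz.trans hx.1, hx.2.le⟩
  · exact fun x hx => (h.tail_tail_pos ⟨hz.trans hx.1, hx.2⟩).ne'
  · exact fun x hx => (sub_pos.2 hx.2).ne'

/-- Since `h' = -w`, a lower bound on `h/w` is a bound on the logarithmic derivative of `h`. -/
theorem monotoneOn_log_tail_tail_sub (h : InitialDensity c₀) {μ z : ℝ} (hμ : 0 < μ)
    (hz : z ∈ Ico (0 : ℝ) 1)
    (hb : ∀ x ∈ Ico z 1, μ * (1 - x) * tail c₀ x ≤ tail (tail c₀) x) :
    MonotoneOn (fun x => Real.log (tail (tail c₀) x) - μ⁻¹ * Real.log (1 - x)) (Ico z 1) := by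
  have hd : ∀ x ∈ interior (Ico z 1), x ∈ Ioo (0 : ℝ) 1 ∧ x ∈ Ico z 1 := fun x hx => by
    rw [interior_Ico] at hx
    exact ⟨⟨hz.1.trans_lt hx.1, hx.2⟩, hx.1.le, hx.2⟩
  refine monotoneOn_of_deriv_nonneg (convex_Ico z 1) (h.log_sub_continuousOn _ hz.1)
    (fun x hx => (h.log_sub_hasDerivAt _ (hd x hx).1).differentiableAt.differentiableWithinAt)
    fun x hx => ?_
  obtain ⟨hx0, hxz⟩ := hd x hx
  rw [(h.log_sub_hasDerivAt _ hx0).deriv]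
  have hH := h.tail_tail_pos (c₀ := c₀) ⟨hx0.1.le, hx0.2⟩
  have h1x : 0 < 1 - x := sub_pos.2 hx0.2
  have : tail c₀ x / tail (tail c₀) x ≤ μ⁻¹ * (1 / (1 - x)) := by
    rw [← one_div, div_mul_div_comm, one_mul, div_le_div_iff₀ hH (mul_pos hμ h1x), one_mul]
    linarith [hb x hxz]
  rw [neg_div, neg_div, mul_neg]
  linarith

theorem antitoneOn_log_tail_tail_sub (h : InitialDensity c₀) {ν z : ℝ} (hν : 0 < ν)
    (hz : z ∈ Ico (0 : ℝ) 1)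
    (hb : ∀ x ∈ Ico z 1, tail (tail c₀) x ≤ ν * (1 - x) * tail c₀ x) :
    AntitoneOn (fun x => Real.log (tail (tail c₀) x) - ν⁻¹ * Real.log (1 - x)) (Ico z 1) := by
  have hd : ∀ x ∈ interior (Ico z 1), x ∈ Ioo (0 : ℝ) 1 ∧ x ∈ Ico z 1 := fun x hx => by
    rw [interior_Ico] at hx
    exact ⟨⟨hz.1.trans_lt hx.1, hx.2⟩, hx.1.le, hx.2⟩
  refine antitoneOn_of_deriv_nonpos (convex_Ico z 1) (h.log_sub_continuousOn _ hz.1)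
    (fun x hx => (h.log_sub_hasDerivAt _ (hd x hx).1).differentiableAt.differentiableWithinAt)
    fun x hx => ?_
  obtain ⟨hx0, hxz⟩ := hd x hx
  rw [(h.log_sub_hasDerivAt _ hx0).deriv]
  have hH := h.tail_tail_pos (c₀ := c₀) ⟨hx0.1.le, hx0.2⟩
  have h1x : 0 < 1 - x := sub_pos.2 hx0.2
  have : ν⁻¹ * (1 / (1 - x)) ≤ tail c₀ x / tail (tail c₀) x := by
    rw [← one_div, div_mul_div_comm, one_mul, div_le_div_iff₀ (mul_pos hν h1x) hH, one_mul]
    linarith [hb x hxz]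
  rw [neg_div, neg_div, mul_neg]
  linarith

theorem log_tail_tail_le_add (h : InitialDensity c₀) {x : ℝ} (hx : x ∈ Ico (0 : ℝ) 1) :
    Real.log (tail (tail c₀) x) ≤ Real.log (1 - x) + Real.log (tail c₀ x) := by
  rw [← Real.log_mul (sub_pos.2 hx.2).ne' (h.tail_pos x hx).ne']
  exact Real.log_le_log (h.tail_tail_pos hx) (h.tail_tail_le (Ico_subset_Icc_self hx))

theorem add_log_le_log_tail_tail (h : InitialDensity c₀) {m x : ℝ} (hm : 0 < m)
    (hx : x ∈ Ico (0 : ℝ) 1) (hb : m * (1 - x) * tail c₀ x ≤ tail (tail c₀) x) :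
    Real.log m + Real.log (1 - x) + Real.log (tail c₀ x) ≤ Real.log (tail (tail c₀) x) := by
  have h1x : 0 < 1 - x := sub_pos.2 hx.2
  have hW := h.tail_pos x hx
  rw [← Real.log_mul hm.ne' h1x.ne', ← Real.log_mul (by positivity) hW.ne']
  exact Real.log_le_log (by positivity) hb

/-- The bound `h ≥ m (1 - x) w` gives a power-law bound for `h`, and it makes `h` comparable to
`(1 - x) w`, so that the bound passes to `w`. -/
theorem exists_log_tail_ge (h : InitialDensity c₀) {β₀ : ℝ} (hβ₀ : 0 < β₀) (hβ₁ : β₀ < 1)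
    (hβ : Tendsto (beta c₀) (𝓝[<] 1) (𝓝 β₀)) :
    ∃ M q : ℝ, 0 < q ∧ TailLowerBound c₀ M q := by
  obtain ⟨m, hm, hb⟩ := h.exists_le_tail_tail hβ₀ hβ₁ hβ
  refine ⟨-Real.log m, m⁻¹, inv_pos.2 hm, fun x hx y hy => ?_⟩
  have hy0 : y ∈ Ico (0 : ℝ) 1 := ⟨hx.1.trans hy.1, hy.2⟩
  have h1 := h.monotoneOn_log_tail_tail_sub hm (by simp : (0 : ℝ) ∈ Ico (0 : ℝ) 1) hb hx hy0 hy.1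
  have h2 := h.add_log_le_log_tail_tail hm hx (hb x hx)
  have h3 := h.log_tail_tail_le_add hy0
  have h4 : Real.log (1 - y) ≤ Real.log (1 - x) :=
    Real.log_le_log (sub_pos.2 hy.2) (by linarith [hy.1])
  simp only at h1
  linarith

/-- The tail decays by a factor of two, uniformly in `x`, when the distance to `1` shrinks by a
suitable factor: near `1` because `β₀ > 0` gives an upper power-law bound with positive exponent,
and elsewhere because the tail is continuous and vanishes at `1`. -/
theorem exists_tail_le_half (h : InitialDensity c₀) {β₀ : ℝ} (hβ₀ : 0 < β₀) (hβ₁ : β₀ < 1)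
    (hβ : Tendsto (beta c₀) (𝓝[<] 1) (𝓝 β₀)) :
    ∃ ρ ∈ Ioo (0 : ℝ) 1, ∀ x ∈ Ico (0 : ℝ) 1,
      tail c₀ (1 - ρ * (1 - x)) ≤ tail c₀ x / 2 := by
  obtain ⟨m, hm, hb⟩ := h.exists_le_tail_tail hβ₀ hβ₁ hβ
  set ν := 1 - β₀ / 2 with hνdef
  have hν : 0 < ν := by linarith
  obtain ⟨z, hz, hzs⟩ := h.eventually_tail_tail_le hβ (show 1 - β₀ < ν by linarith)
    (show ν < 1 by linarith)
  have hν1 : 0 < ν⁻¹ - 1 := by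
    have := one_lt_inv₀ hν |>.2 (by linarith)
    linarith
  have e1 : ∀ᶠ ρ in 𝓝[>] (0 : ℝ), (ν⁻¹ - 1) * Real.log ρ ≤ Real.log m - Real.log 2 :=
    (Real.tendsto_log_nhdsGT_zero.const_mul_atBot hν1).eventually_le_atBot _
  have hWc : Tendsto (fun ρ => tail c₀ (1 - ρ)) (𝓝[>] (0 : ℝ)) (𝓝 0) := by
    have h1 := h.tail_continuousOn 1 (by simp)
    rw [ContinuousWithinAt, tail_one] at h1
    refine h1.comp (tendsto_nhdsWithin_iff.2 ⟨?_, ?_⟩)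
    · have : Tendsto (fun z : ℝ => 1 - z) (𝓝 0) (𝓝 (1 - 0)) := Continuous.tendsto (by fun_prop) 0
      rw [sub_zero] at this
      exact tendsto_nhdsWithin_of_tendsto_nhds this
    · filter_upwards [Ioo_mem_nhdsGT (zero_lt_one' ℝ)] with ρ hρ
      exact ⟨by linarith [hρ.2], by linarith [hρ.1]⟩
  have e2 := hWc.eventually_le_const (half_pos (h.tail_pos z hz))
  obtain ⟨ρ, hρ1, hρ2, hρ⟩ := (e1.and (e2.and (Ioo_mem_nhdsGT (zero_lt_one' ℝ)))).exists
  refine ⟨ρ, hρ, fun x hx => ?_⟩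
  have h1x : 0 < 1 - x := sub_pos.2 hx.2
  have hpos : 0 < ρ * (1 - x) := mul_pos hρ.1 h1x
  have hle : ρ * (1 - x) ≤ 1 - x := by nlinarith [hρ.2]
  have hle' : ρ * (1 - x) ≤ ρ := by nlinarith [hρ.1, hx.1]
  have hy : 1 - ρ * (1 - x) ∈ Ico (0 : ℝ) 1 := ⟨by linarith [hx.1], by linarith⟩
  rcases le_total x z with hxz | hxz
  · calc tail c₀ (1 - ρ * (1 - x)) ≤ tail c₀ (1 - ρ) :=
          h.tail_antitoneOn ⟨by linarith [hρ.2], by linarith [hρ.1]⟩ (Ico_subset_Icc_self hy)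
            (by linarith)
      _ ≤ tail c₀ z / 2 := hρ2
      _ ≤ tail c₀ x / 2 := by
          have := h.tail_antitoneOn (Ico_subset_Icc_self hx) (Ico_subset_Icc_self hz) hxz
          linarith
  · have h1 := h.antitoneOn_log_tail_tail_sub hν hz hzs ⟨hxz, hx.2⟩
      (show 1 - ρ * (1 - x) ∈ Ico z 1 from ⟨by linarith, hy.2⟩) (by linarith)
    have h2 := h.add_log_le_log_tail_tail hm hy (hb _ hy)
    have h3 := h.log_tail_tail_le_add hx
    simp only [sub_sub_cancel] at h1 h2
    rw [Real.log_mul hρ.1.ne' h1x.ne'] at h1 h2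
    rw [← Real.log_le_log_iff (h.tail_pos _ hy) (half_pos (h.tail_pos x hx)),
      Real.log_div (h.tail_pos x hx).ne' two_ne_zero]
    linarith

/-- The limit `β₀` of the beta function at `1` determines the decay exponent of the tail. -/
theorem tendsto_log_tail_div (h : InitialDensity c₀) {β₀ : ℝ} (hβ₀ : 0 < β₀) (hβ₁ : β₀ < 1)
    (hβ : Tendsto (beta c₀) (𝓝[<] 1) (𝓝 β₀)) :
    Tendsto (fun z => Real.log (tail c₀ z) / Real.log (1 - z)) (𝓝[<] 1)
      (𝓝 ((1 - β₀)⁻¹ - 1)) := by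
  obtain ⟨m, hm, hb⟩ := h.exists_le_tail_tail hβ₀ hβ₁ hβ
  have h1β : 0 < 1 - β₀ := by linarith
  have hinv : Tendsto (fun ν : ℝ => ν⁻¹ - 1) (𝓝 (1 - β₀)) (𝓝 ((1 - β₀)⁻¹ - 1)) :=
    (tendsto_inv₀ h1β.ne').sub_const 1
  have hneg : ∀ᶠ z in 𝓝[<] (1 : ℝ), Real.log (1 - z) < 0 :=
    tendsto_one_sub_log.eventually_lt_atBot 0
  have hlim : ∀ C q : ℝ, Tendsto (fun z : ℝ => C / Real.log (1 - z) + q) (𝓝[<] 1) (𝓝 q) := by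
    intro C q
    simpa using ((tendsto_const_nhds (x := C)).div_atBot tendsto_one_sub_log).add_const q
  refine tendsto_order.2 ⟨fun q hq => ?_, fun q hq => ?_⟩
  · obtain ⟨ν, hνq, hν⟩ := (((hinv.eventually_const_lt hq).filter_mono nhdsWithin_le_nhds).and
      (Ioo_mem_nhdsGT (show 1 - β₀ < 1 by linarith))).exists
    obtain ⟨z, hz, hzs⟩ := h.eventually_tail_tail_le hβ hν.1 hν.2
    set C := Real.log (tail (tail c₀) z) - ν⁻¹ * Real.log (1 - z) - Real.log m
    filter_upwards [hneg, (hlim C (ν⁻¹ - 1)).eventually_const_lt hνq,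
      Ico_mem_nhdsLT hz.2] with x hx1 hx2 hx
    have hx0 : x ∈ Ico (0 : ℝ) 1 := ⟨hz.1.trans hx.1, hx.2⟩
    have h1 := h.antitoneOn_log_tail_tail_sub (h1β.trans hν.1) hz hzs ⟨le_rfl, hz.2⟩ hx hx.1
    have h2 := h.add_log_le_log_tail_tail hm hx0 (hb x hx0)
    refine hx2.trans_le ?_
    rw [le_div_iff_of_neg hx1, add_mul, div_mul_cancel₀ _ hx1.ne]
    simp only [C] at h1 ⊢
    linarith
  · obtain ⟨μ, hμq, hμ⟩ := (((hinv.eventually_lt_const hq).filter_mono nhdsWithin_le_nhds).and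
      (Ioo_mem_nhdsLT h1β)).exists
    obtain ⟨z, hz, hzs⟩ := h.eventually_le_tail_tail hβ₀ hβ hμ.2
    set C := Real.log (tail (tail c₀) z) - μ⁻¹ * Real.log (1 - z)
    filter_upwards [hneg, (hlim C (μ⁻¹ - 1)).eventually_lt_const hμq,
      Ico_mem_nhdsLT hz.2] with x hx1 hx2 hx
    have hx0 : x ∈ Ico (0 : ℝ) 1 := ⟨hz.1.trans hx.1, hx.2⟩
    have h1 := h.monotoneOn_log_tail_tail_sub hμ.1 hz hzs ⟨le_rfl, hz.2⟩ hx hx.1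
    have h2 := h.log_tail_tail_le_add hx0
    refine lt_of_le_of_lt ?_ hx2
    rw [div_le_iff_of_neg hx1, add_mul, div_mul_cancel₀ _ hx1.ne]
    simp only [C] at h1 ⊢
    linarith

end InitialDensity

/-! ### Characteristics -/

/-- The mean value inequality for a function with a derivative in the interior. -/
theorem sub_le_mul_of_hasDerivAt_le {f f' : ℝ → ℝ} {s t C : ℝ} (hst : s ≤ t)
    (hf : ContinuousOn f (Icc s t)) (hd : ∀ r ∈ Ioo s t, HasDerivAt f (f' r) r)
    (hC : ∀ r ∈ Ioo s t, f' r ≤ C) : f t - f s ≤ (t - s) * C := by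
  have := intervalIntegral.sub_le_integral_of_hasDeriv_right_of_le hst hf
    (fun r hr => (hd r hr).hasDerivWithinAt) (integrableOn_const (C := C) (by simp)) hC
  simpa using this

namespace IsCharacteristic

variable {φ ψ κ : ℝ → ℝ} {t : ℝ} {X Y : ℝ → ℝ}

theorem continuousOn (hX : IsCharacteristic φ ψ κ t X) : ContinuousOn X (Icc 0 t) :=
  fun s hs => (hX s hs).2.continuousWithinAt

theorem hasDerivAt (hX : IsCharacteristic φ ψ κ t X) {s : ℝ} (hs : s ∈ Ioo 0 t) :
    HasDerivAt X (φ (X s) - κ s * ψ (X s)) s :=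
  (hX s (Ioo_subset_Icc_self hs)).2.hasDerivAt (Icc_mem_nhds hs.1 hs.2)

theorem log_continuousOn (hX : IsCharacteristic φ ψ κ t X) :
    ContinuousOn (fun s => Real.log (1 - X s)) (Icc 0 t) :=
  (continuousOn_const.sub hX.continuousOn).log fun s hs => (sub_pos.2 (hX s hs).1.2).ne'

/-- The distance to `1` along a characteristic grows at the logarithmic rate
`κ ψ/(1-x) - φ/(1-x)`. -/
theorem log_hasDerivAt (hX : IsCharacteristic φ ψ κ t X) {s : ℝ} (hs : s ∈ Ioo 0 t) :
    HasDerivAt (fun s => Real.log (1 - X s)) (κ s * chord ψ (X s) - chord φ (X s)) s := by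
  have h1 : 0 < 1 - X s := sub_pos.2 (hX s (Ioo_subset_Icc_self hs)).1.2
  convert ((hX.hasDerivAt hs).const_sub 1).log h1.ne' using 1
  rw [chord, chord]
  field_simp
  ring

/-- Characteristics cannot merge backwards in time, since the transport field is bounded below by
`φ'(1)` times the distance: their order at the end time is their order at all times. -/
theorem le_of_le (h : Coefficients φ ψ) (hκ : ∀ s ∈ Icc 0 t, 0 ≤ κ s)
    (hX : IsCharacteristic φ ψ κ t X) (hY : IsCharacteristic φ ψ κ t Y) (hXY : X t ≤ Y t)
    {s : ℝ} (hs : s ∈ Icc 0 t) : X s ≤ Y s := by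
  by_contra! hlt
  -- `X - Y` cannot fall below the exponential barrier with rate `A`, which exceeds `-φ'(1)`.
  set A := 1 - derivWithin φ (Ioc 0 1) 1 with hA
  set D := X s - Y s with hD
  have hDpos : 0 < D := sub_pos.2 hlt
  have hsub : Icc s t ⊆ Icc 0 t := Icc_subset_Icc_left hs.1
  have hB : ∀ r, HasDerivAt (fun r => -(D * Real.exp (-A * (r - s))))
      (A * (D * Real.exp (-A * (r - s)))) r := by
    intro r
    have h1 : HasDerivAt (fun r : ℝ => -A * (r - s)) (-A) r := by
      simpa using ((hasDerivAt_id r).sub_const s).const_mul (-A)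
    exact ((h1.exp.const_mul D).neg).congr_deriv (by ring)
  have key := image_le_of_deriv_right_lt_deriv_boundary (f := fun r => Y r - X r) (a := s) (b := t)
    (f' := fun r => (φ (Y r) - κ r * ψ (Y r)) - (φ (X r) - κ r * ψ (X r)))
    ((hY.continuousOn.sub hX.continuousOn).mono hsub)
    (fun r hr => by
      have hr0 : r ∈ Ico 0 t := ⟨hs.1.trans hr.1, hr.2⟩
      have hn : Icc 0 t ∈ 𝓝[≥] r := Icc_mem_nhdsGE_of_mem hr0
      exact ((hY r (Ico_subset_Icc_self hr0)).2.mono_of_mem_nhdsWithin hn).sub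
        ((hX r (Ico_subset_Icc_self hr0)).2.mono_of_mem_nhdsWithin hn))
    (by simp [hD]) hB
    (fun r hr heq => by
      have hr0 : r ∈ Icc 0 t := ⟨hs.1.trans hr.1, hr.2.le⟩
      set E := D * Real.exp (-A * (r - s)) with hE
      have hEpos : 0 < E := by positivity
      have hlt' : Y r < X r := by linarith
      have h1 := h.phi_sub_ge (hY r hr0).1 (hX r hr0).1 hlt'
      have h2 := h.psi_antitoneOn (hY r hr0).1 (hX r hr0).1 hlt'.le
      have h3 := mul_le_mul_of_nonneg_left h2 (hκ r hr0)
      have h4 : X r - Y r = E := by linarith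
      rw [h4] at h1
      have h5 : A * E = E - derivWithin φ (Ioc 0 1) 1 * E := by rw [hA]; ring
      rw [h5]
      linarith)
    (right_mem_Icc.2 hs.2)
  have hpos : 0 < D * Real.exp (-A * (t - s)) := by positivity
  linarith

/-- Relative distances to `1` increase backwards in time, because `φ/(1-x)` is increasing and
`ψ/(1-x)` is decreasing. -/
theorem log_sub_log_le (h : Coefficients φ ψ) (ht : 0 ≤ t) (hκ : ∀ s ∈ Icc 0 t, 0 ≤ κ s)
    (hX : IsCharacteristic φ ψ κ t X) (hY : IsCharacteristic φ ψ κ t Y) (hXY : X t ≤ Y t) :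
    Real.log (1 - Y t) - Real.log (1 - X t) ≤ Real.log (1 - Y 0) - Real.log (1 - X 0) := by
  have := sub_le_mul_of_hasDerivAt_le (C := 0) ht (hY.log_continuousOn.sub hX.log_continuousOn)
    (fun r hr => (hY.log_hasDerivAt hr).sub (hX.log_hasDerivAt hr)) (fun r hr => by
      have hr0 := Ioo_subset_Icc_self hr
      have hle := le_of_le h hκ hX hY hXY hr0
      have h1 := h.monotoneOn_chord_phi (hX r hr0).1 (hY r hr0).1 hle
      have h2 := mul_le_mul_of_nonneg_left
        (h.antitoneOn_chord_psi (hX r hr0).1 (hY r hr0).1 hle) (hκ r hr0)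
      linarith)
  simp only [Pi.sub_apply, mul_zero] at this
  linarith

end IsCharacteristic

/-! ### Shape of the solution -/

namespace IsSolution

variable {φ ψ c₀ : ℝ → ℝ} {w : ℝ → ℝ → ℝ} {κ : ℝ → ℝ}

/-- A negative `κ t` would make the characteristic through `(0,t)` enter from outside `[0,1)`. -/
theorem kappa_nonneg (h : Coefficients φ ψ) (hs : IsSolution φ ψ c₀ w κ) {t : ℝ} (ht : 0 ≤ t) :
    0 ≤ κ t := by
  have hpos : ∀ t, 0 < t → 0 ≤ κ t := by
    intro t ht
    obtain ⟨X, hX, hXt, -⟩ := hs.transport t ht.le 0 (by simp)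
    have hd := (hX t ⟨ht.le, le_rfl⟩).2
    have h2 := (hasDerivWithinAt_iff_tendsto_slope' (by simp)).1 (hd.mono Ico_subset_Icc_self)
    have hne : (𝓝[Ico 0 t] t).NeBot := by
      rw [nhdsWithin_Ico_eq_nhdsLT ht]
      infer_instance
    have h3 := le_of_tendsto h2 (b := 0) (by
      filter_upwards [self_mem_nhdsWithin] with s hs'
      rw [slope_def_field, hXt, sub_zero]
      exact div_nonpos_of_nonneg_of_nonpos (hX s (Ico_subset_Icc_self hs')).1.1
        (by linarith [hs'.2]))
    rw [hXt, h.phi_zero, zero_sub] at h3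
    exact nonneg_of_mul_nonneg_left (by linarith) h.psi_zero_pos
  have hc : Tendsto κ (𝓝[>] t) (𝓝 (κ t)) :=
    (hs.cont t ht).mono (fun s hs' => ht.trans (mem_Ioi.1 hs').le)
  refine ge_of_tendsto hc ?_
  filter_upwards [self_mem_nhdsWithin] with s hs'
  exact hpos s (ht.trans_lt hs')

theorem exists_characteristic (hs : IsSolution φ ψ c₀ w κ) {t : ℝ} (ht : 0 ≤ t)
    {x : ℝ} (hx : x ∈ Ico (0 : ℝ) 1) :
    ∃ X : ℝ → ℝ, IsCharacteristic φ ψ κ t X ∧ X t = x ∧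
      ∀ s ∈ Icc 0 t, w (X s) s = Real.exp s * tail c₀ (X 0) := by
  obtain ⟨X, hX, hXt, hw⟩ := hs.transport t ht x hx
  refine ⟨X, hX, hXt, fun s hs' => ?_⟩
  have hd : ∀ r ∈ Icc 0 t, HasDerivWithinAt (fun r => Real.exp (-r) * w (X r) r) 0 (Icc 0 t) r := by
    intro r hr
    have h1 : HasDerivWithinAt (fun r : ℝ => Real.exp (-r)) (-Real.exp (-r)) (Icc 0 t) r := by
      simpa using ((hasDerivAt_neg r).exp).hasDerivWithinAt
    exact (h1.mul (hw r hr)).congr_deriv (by ring)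
  have hc := constant_of_has_deriv_right_zero (fun r hr => (hd r hr).continuousWithinAt)
    (fun r hr => (hd r (Ico_subset_Icc_self hr)).mono_of_mem_nhdsWithin
      (Icc_mem_nhdsGE_of_mem hr)) s hs'
  rw [neg_zero, Real.exp_zero, one_mul, hs.initial _ (hX 0 ⟨le_rfl, ht⟩).1] at hc
  rw [← hc, ← mul_assoc, ← Real.exp_add, add_neg_cancel, Real.exp_zero, one_mul]

theorem pos (hc₀ : InitialDensity c₀) (hs : IsSolution φ ψ c₀ w κ) {t : ℝ} (ht : 0 ≤ t)
    {x : ℝ} (hx : x ∈ Ico (0 : ℝ) 1) : 0 < w x t := by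
  obtain ⟨X, hX, rfl, hw⟩ := hs.exists_characteristic ht hx
  rw [hw t ⟨ht, le_rfl⟩]
  exact mul_pos (Real.exp_pos t) (hc₀.tail_pos _ (hX 0 ⟨le_rfl, ht⟩).1)

theorem antitoneOn (h : Coefficients φ ψ) (hc₀ : InitialDensity c₀)
    (hs : IsSolution φ ψ c₀ w κ) {t : ℝ} (ht : 0 ≤ t) :
    AntitoneOn (fun x => w x t) (Ico 0 1) := by
  intro x hx y hy hxy
  obtain ⟨X, hX, rfl, hwX⟩ := hs.exists_characteristic ht hx
  obtain ⟨Y, hY, rfl, hwY⟩ := hs.exists_characteristic ht hy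
  have h0 : (0 : ℝ) ∈ Icc 0 t := ⟨le_rfl, ht⟩
  simp only
  rw [hwX t ⟨ht, le_rfl⟩, hwY t ⟨ht, le_rfl⟩]
  exact mul_le_mul_of_nonneg_left (hc₀.tail_antitoneOn (Ico_subset_Icc_self (hX 0 h0).1)
    (Ico_subset_Icc_self (hY 0 h0).1) (hX.le_of_le h (fun s hs' => hs.kappa_nonneg h hs'.1)
      hY hxy h0)) (Real.exp_pos t).le

/-- The power-law lower bound of the initial tail is inherited at all times. -/
theorem log_ge (h : Coefficients φ ψ) (hc₀ : InitialDensity c₀) (hs : IsSolution φ ψ c₀ w κ)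
    {M q : ℝ} (hq : 0 < q)
    (hMq : TailLowerBound c₀ M q)
    {t : ℝ} (ht : 0 ≤ t) {x y : ℝ} (hx : x ∈ Ico (0 : ℝ) 1) (hy : y ∈ Ico (0 : ℝ) 1)
    (hxy : x ≤ y) :
    Real.log (w x t) + q * (Real.log (1 - y) - Real.log (1 - x)) - M ≤ Real.log (w y t) := by
  obtain ⟨X, hX, rfl, hwX⟩ := hs.exists_characteristic ht hx
  obtain ⟨Y, hY, rfl, hwY⟩ := hs.exists_characteristic ht hy
  have h0 : (0 : ℝ) ∈ Icc 0 t := ⟨le_rfl, ht⟩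
  have hκ : ∀ s ∈ Icc 0 t, 0 ≤ κ s := fun s hs' => hs.kappa_nonneg h hs'.1
  have hX0 := (hX 0 h0).1
  have hY0 := (hY 0 h0).1
  rw [hwX t ⟨ht, le_rfl⟩, hwY t ⟨ht, le_rfl⟩,
    Real.log_mul (Real.exp_pos t).ne' (hc₀.tail_pos _ hX0).ne',
    Real.log_mul (Real.exp_pos t).ne' (hc₀.tail_pos _ hY0).ne']
  have h1 := hMq _ hX0 _ ⟨hX.le_of_le h hκ hY hxy h0, hY0.2⟩
  have h2 := mul_le_mul_of_nonneg_left (hX.log_sub_log_le h ht hκ hY hxy) hq.le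
  linarith

/-! ### Consequences of the conservation law -/

theorem intervalIntegrable (hs : IsSolution φ ψ c₀ w κ) {t : ℝ} (ht : 0 ≤ t)
    {x y : ℝ} (hx : x ∈ Icc (0 : ℝ) 1) (hy : y ∈ Icc (0 : ℝ) 1) :
    IntervalIntegrable (fun x => w x t) volume x y := by
  -- The integral of a non-integrable function is `0` by convention, but here it is `1`.
  have h1 : IntervalIntegrable (fun x => w x t) volume 0 1 := by
    by_contra hn
    have := hs.mass t ht
    rw [intervalIntegral.integral_undef hn] at this
    exact zero_ne_one this
  exact h1.mono_set (by rw [uIcc_of_le zero_le_one]; exact uIcc_subset_Icc hx hy)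

theorem integral_add (hs : IsSolution φ ψ c₀ w κ) {t : ℝ} (ht : 0 ≤ t)
    {x : ℝ} (hx : x ∈ Icc (0 : ℝ) 1) :
    (∫ y in (0 : ℝ)..x, w y t) + ∫ y in x..1, w y t = 1 := by
  refine Eq.trans ?_ (hs.mass t ht)
  exact intervalIntegral.integral_add_adjacent_intervals
    (hs.intervalIntegrable ht (x := 0) (by simp) hx)
    (hs.intervalIntegrable ht (y := 1) hx (by simp))

theorem integral_le (h : Coefficients φ ψ) (hc₀ : InitialDensity c₀)
    (hs : IsSolution φ ψ c₀ w κ) {t : ℝ} (ht : 0 ≤ t) {x y : ℝ} (hx : x ∈ Ico (0 : ℝ) 1)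
    (hy : y ≤ 1) (hxy : x ≤ y) : ∫ z in x..y, w z t ≤ (y - x) * w x t := by
  have := intervalIntegral.integral_mono_on_of_le_Ioo hxy
    (hs.intervalIntegrable ht (Ico_subset_Icc_self hx) ⟨hx.1.trans hxy, hy⟩)
    (intervalIntegrable_const (c := w x t))
    (fun z hz => hs.antitoneOn h hc₀ ht hx ⟨hx.1.trans hz.1.le, hz.2.trans_le hy⟩ hz.1.le)
  simpa using this

theorem le_integral (h : Coefficients φ ψ) (hc₀ : InitialDensity c₀)
    (hs : IsSolution φ ψ c₀ w κ) {t : ℝ} (ht : 0 ≤ t) {x y : ℝ} (hx : 0 ≤ x)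
    (hy : y < 1) (hxy : x ≤ y) : (y - x) * w y t ≤ ∫ z in x..y, w z t := by
  have := intervalIntegral.integral_mono_on_of_le_Ioo hxy
    (intervalIntegrable_const (c := w y t))
    (hs.intervalIntegrable ht ⟨hx, hxy.trans hy.le⟩ ⟨hx.trans hxy, hy.le⟩)
    (fun z hz => hs.antitoneOn h hc₀ ht ⟨hx.trans hz.1.le, hz.2.trans hy⟩
      ⟨hx.trans hxy, hy⟩ hz.2.le)
  simpa using this

theorem integral_nonneg (hc₀ : InitialDensity c₀)
    (hs : IsSolution φ ψ c₀ w κ) {t : ℝ} (ht : 0 ≤ t) {x y : ℝ} (hx : 0 ≤ x)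
    (hy : y ≤ 1) (hxy : x ≤ y) : 0 ≤ ∫ z in x..y, w z t := by
  have := intervalIntegral.integral_mono_on_of_le_Ioo (f := fun _ => 0) hxy
    intervalIntegrable_const
    (hs.intervalIntegrable ht ⟨hx, hxy.trans hy⟩ ⟨hx.trans hxy, hy⟩)
    (fun z hz => (hs.pos hc₀ ht ⟨hx.trans hz.1.le, hz.2.trans_le hy⟩).le)
  simpa using this

theorem one_le_zero (h : Coefficients φ ψ) (hc₀ : InitialDensity c₀)
    (hs : IsSolution φ ψ c₀ w κ) {t : ℝ} (ht : 0 ≤ t) : 1 ≤ w 0 t := by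
  have := hs.integral_le h hc₀ ht (x := 0) (y := 1) (by simp) le_rfl zero_le_one
  rw [hs.mass t ht] at this
  simpa using this

/-- The mass constraint and the power-law lower bound keep `w(0,t)` bounded. -/
theorem log_zero_le (h : Coefficients φ ψ) (hc₀ : InitialDensity c₀)
    (hs : IsSolution φ ψ c₀ w κ) {M q : ℝ} (hq : 0 < q)
    (hMq : TailLowerBound c₀ M q)
    {t : ℝ} (ht : 0 ≤ t) : Real.log (w 0 t) ≤ (1 + q) * Real.log 2 + M := by
  have hhalf : (1 / 2 : ℝ) ∈ Ico (0 : ℝ) 1 := by constructor <;> norm_num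
  have h1 := hs.log_ge h hc₀ hq hMq ht (by simp : (0 : ℝ) ∈ Ico (0 : ℝ) 1) hhalf (by norm_num)
  have h2 := hs.le_integral h hc₀ ht (x := 0) (y := 1 / 2) le_rfl (by norm_num) (by norm_num)
  have h3 := hs.integral_nonneg hc₀ ht (x := 1 / 2) (y := 1) (by norm_num) le_rfl (by norm_num)
  have h4 := hs.integral_add ht (Ico_subset_Icc_self hhalf)
  have h5 : w (1 / 2) t ≤ 2 := by linarith
  have h6 := Real.log_le_log (hs.pos hc₀ ht hhalf) h5
  have h7 : Real.log (1 - 1 / 2) = -Real.log 2 := by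
    rw [← Real.log_inv]; norm_num
  rw [h7, sub_zero, Real.log_one] at h1
  linarith

end IsSolution

/-! ### Comparison of characteristics with the linearized flow at `1` -/

/-- The logarithmic expansion `b ∫₀ᵗ κ - a t` of the distance to `1`, up to time `t`, under the
transport field linearized at `1`, where `a = -φ'(1)` and `b = -ψ'(1)`. -/
noncomputable def linearExpansion (φ ψ κ : ℝ → ℝ) (t : ℝ) : ℝ :=
  -derivWithin ψ (Ioc 0 1) 1 * (∫ s in (0 : ℝ)..t, κ s) - -derivWithin φ (Ioc 0 1) 1 * t

namespace IsSolution

variable {φ ψ c₀ : ℝ → ℝ} {w : ℝ → ℝ → ℝ} {κ : ℝ → ℝ}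

theorem kappa_intervalIntegrable (hs : IsSolution φ ψ c₀ w κ) {t : ℝ} (ht : 0 ≤ t) :
    IntervalIntegrable κ volume 0 t :=
  (hs.cont.mono (by rw [uIcc_of_le ht]; exact Icc_subset_Ici_self)).intervalIntegrable

theorem linearExpansion_hasDerivAt (hs : IsSolution φ ψ c₀ w κ) {t : ℝ} (ht : 0 < t) :
    HasDerivAt (linearExpansion φ ψ κ)
      (-derivWithin ψ (Ioc 0 1) 1 * κ t - -derivWithin φ (Ioc 0 1) 1) t := by
  have h1 : HasDerivAt (fun u => ∫ s in (0 : ℝ)..u, κ s) (κ t) t := by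
    refine intervalIntegral.integral_hasDerivAt_right (hs.kappa_intervalIntegrable ht.le) ?_ ?_
    · exact ContinuousOn.stronglyMeasurableAtFilter isOpen_Ioi
        (hs.cont.mono Ioi_subset_Ici_self) t ht
    · exact hs.cont.continuousAt (Ici_mem_nhds ht)
  exact ((h1.const_mul (-derivWithin ψ (Ioc 0 1) 1)).sub
    ((hasDerivAt_id t).const_mul (-derivWithin φ (Ioc 0 1) 1))).congr_deriv (by rw [mul_one])

theorem linearExpansion_continuousOn (hs : IsSolution φ ψ c₀ w κ) {t : ℝ} (ht : 0 ≤ t) :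
    ContinuousOn (linearExpansion φ ψ κ) (Icc 0 t) := by
  have h1 : ContinuousOn (fun u => ∫ s in (0 : ℝ)..u, κ s) (Icc 0 t) := by
    have := intervalIntegral.continuousOn_primitive_interval (a := 0) (b := t) (μ := volume)
      (f := κ) ((hs.cont.mono
        (by rw [uIcc_of_le ht]; exact Icc_subset_Ici_self)).integrableOn_compact isCompact_uIcc)
    rwa [uIcc_of_le ht] at this
  exact (continuousOn_const.mul h1).sub (by fun_prop)

/-- Looking back from time `t`, characteristics approach `1` exponentially fast: `w` decays by
`e^{-(t-s)}` along them, while it is at least a power of `1 - x`. -/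
theorem log_one_sub_le (h : Coefficients φ ψ) (hc₀ : InitialDensity c₀)
    (hs : IsSolution φ ψ c₀ w κ) {M q : ℝ} (hq : 0 < q)
    (hMq : TailLowerBound c₀ M q)
    {t : ℝ} {X : ℝ → ℝ} (hX : IsCharacteristic φ ψ κ t X)
    (hw : ∀ s ∈ Icc 0 t, w (X s) s = Real.exp s * tail c₀ (X 0)) {s : ℝ} (hst : s ∈ Icc 0 t) :
    q * Real.log (1 - X s) ≤ (1 + q) * Real.log 2 + M + M - (t - s) := by
  have ht : 0 ≤ t := hst.1.trans hst.2
  have htt : t ∈ Icc 0 t := ⟨ht, le_rfl⟩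
  have hW := hc₀.tail_pos _ (hX 0 ⟨le_rfl, ht⟩).1
  have e1 : Real.log (w (X s) s) = s + Real.log (tail c₀ (X 0)) := by
    rw [hw s hst, Real.log_mul (Real.exp_pos s).ne' hW.ne', Real.log_exp]
  have e2 : Real.log (w (X t) t) = t + Real.log (tail c₀ (X 0)) := by
    rw [hw t htt, Real.log_mul (Real.exp_pos t).ne' hW.ne', Real.log_exp]
  have h1 := hs.log_zero_le h hc₀ hq hMq ht
  have h2 : Real.log (w (X t) t) ≤ Real.log (w 0 t) :=
    Real.log_le_log (hs.pos hc₀ ht (hX t htt).1)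
      (hs.antitoneOn h hc₀ ht (by simp) (hX t htt).1 (hX t htt).1.1)
  have h3 := hs.log_ge h hc₀ hq hMq hst.1 (by simp : (0 : ℝ) ∈ Ico (0 : ℝ) 1) (hX s hst).1
    (hX s hst).1.1
  have h4 := Real.log_nonneg (hs.one_le_zero h hc₀ hst.1)
  rw [sub_zero, Real.log_one, sub_zero] at h3
  linarith

/-- The expansion along any characteristic agrees with the linearized one up to a constant that
is uniform in the time, the end point and the solution. The relative speed differs from the
linearized one by at most `L (1 + κ) (1 - X)`; here `∫ (1 - X)` is bounded by the exponential
approach to `1`, and so is `∫ κ (1 - X)`, because `κ b (1 - X) ≤ (1 - X)' + a (1 - X)`. -/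
theorem exists_linearExpansion_bound (h : Coefficients φ ψ) (hc₀ : InitialDensity c₀) {β₀ : ℝ}
    (hβ₀ : 0 < β₀) (hβ₁ : β₀ < 1) (hβ : Tendsto (beta c₀) (𝓝[<] 1) (𝓝 β₀)) :
    ∃ K : ℝ, ∀ (w : ℝ → ℝ → ℝ) (κ : ℝ → ℝ), IsSolution φ ψ c₀ w κ →
      ∀ (t : ℝ) (X : ℝ → ℝ), 0 ≤ t → IsCharacteristic φ ψ κ t X →
        (∀ s ∈ Icc 0 t, w (X s) s = Real.exp s * tail c₀ (X 0)) →
        linearExpansion φ ψ κ t ≤ Real.log (1 - X t) - Real.log (1 - X 0) ∧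
        Real.log (1 - X t) - Real.log (1 - X 0) ≤ linearExpansion φ ψ κ t + K := by
  obtain ⟨M, q, hq, hMq⟩ := hc₀.exists_log_tail_ge hβ₀ hβ₁ hβ
  obtain ⟨L, hL, hLb⟩ := h.exists_chord_rate
  set a := -derivWithin φ (Ioc 0 1) 1 with ha
  set b := -derivWithin ψ (Ioc 0 1) 1 with hb
  have ha0 : 0 < a := by linarith [h.deriv_phi_lt]
  have hb0 : 0 < b := by linarith [h.deriv_psi_lt]
  set D := Real.exp (((1 + q) * Real.log 2 + M + M) / q) with hD
  have hD0 : 0 < D := Real.exp_pos _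
  refine ⟨L / b + L * (1 + a / b) * q * D, fun w κ hs t X ht hX hw => ?_⟩
  have hX0 := (hX 0 ⟨le_rfl, ht⟩).1
  have hXt := (hX t ⟨ht, le_rfl⟩).1
  have hΘ0 : linearExpansion φ ψ κ 0 = 0 := by simp [linearExpansion]
  have hUc : ContinuousOn (fun s => Real.log (1 - X s) - linearExpansion φ ψ κ s) (Icc 0 t) :=
    hX.log_continuousOn.sub (hs.linearExpansion_continuousOn ht)
  have hUd : ∀ s ∈ Ioo 0 t, HasDerivAt (fun s => Real.log (1 - X s) - linearExpansion φ ψ κ s)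
      ((κ s * chord ψ (X s) - chord φ (X s)) - (b * κ s - a)) s :=
    fun s hst => (hX.log_hasDerivAt hst).sub (hs.linearExpansion_hasDerivAt hst.1)
  constructor
  · have := sub_le_mul_of_hasDerivAt_le (C := 0) ht hUc.neg (fun s hst => (hUd s hst).neg)
      (fun s hst => by
        have hXs := (hX s (Ioo_subset_Icc_self hst)).1
        have h1 := h.chord_phi_le hXs
        have h2 := mul_le_mul_of_nonneg_left (h.le_chord_psi hXs) (hs.kappa_nonneg h hst.1.le)
        linarith)
    simp only [Pi.neg_apply, hΘ0] at this
    linarith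
  -- The exponential majorant of `1 - X` is integrated explicitly, so that the difference of the
  -- two expansions, corrected by the bounds for both integrals, is decreasing.
  · have hEd : ∀ s, HasDerivAt (fun s => q * (D * Real.exp (-(t - s) / q)))
        (D * Real.exp (-(t - s) / q)) s := by
      intro s
      have h1 : HasDerivAt (fun s : ℝ => -(t - s) / q) (1 / q) s := by
        simpa using (((hasDerivAt_id s).const_sub t).neg).div_const q
      exact ((h1.exp.const_mul D).const_mul q).congr_deriv (by field_simp)
    have hdecay : ∀ s ∈ Icc 0 t, 1 - X s ≤ D * Real.exp (-(t - s) / q) := by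
      intro s hst
      have h1 := hs.log_one_sub_le h hc₀ hq hMq hX hw hst
      have h2 : 0 < 1 - X s := sub_pos.2 (hX s hst).1.2
      rw [hD, ← Real.exp_add, ← Real.log_le_iff_le_exp h2, ← add_div, le_div_iff₀ hq]
      linarith
    have hfd : ∀ s ∈ Ioo 0 t, HasDerivAt
        (fun s => (Real.log (1 - X s) - linearExpansion φ ψ κ s) - L / b * (1 - X s)
          - L * (1 + a / b) * (q * (D * Real.exp (-(t - s) / q))))
        (((κ s * chord ψ (X s) - chord φ (X s)) - (b * κ s - a))
          - L / b * (-(φ (X s) - κ s * ψ (X s)))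
          - L * (1 + a / b) * (D * Real.exp (-(t - s) / q))) s := fun s hst =>
      ((hUd s hst).sub (((hX.hasDerivAt hst).const_sub 1).const_mul _)).sub
        ((hEd s).const_mul _)
    have hfc : ContinuousOn
        (fun s => (Real.log (1 - X s) - linearExpansion φ ψ κ s) - L / b * (1 - X s)
          - L * (1 + a / b) * (q * (D * Real.exp (-(t - s) / q)))) (Icc 0 t) := by
      refine (hUc.sub (continuousOn_const.mul (continuousOn_const.sub hX.continuousOn))).sub ?_
      exact continuousOn_const.mul fun s _ => (hEd s).continuousAt.continuousWithinAt
    have key := sub_le_mul_of_hasDerivAt_le (C := 0) ht hfc hfd (fun s hst => by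
      have hst' := Ioo_subset_Icc_self hst
      have hXs := (hX s hst').1
      have h1s : 0 < 1 - X s := sub_pos.2 hXs.2
      have hκ := hs.kappa_nonneg h hst.1.le
      obtain ⟨g1, g2⟩ := hLb _ hXs
      have g2' : chord ψ (X s) - b ≤ L * (1 - X s) := by rw [hb]; linarith
      have g3 := mul_le_mul_of_nonneg_left g2' hκ
      have g4 : φ (X s) ≤ a * (1 - X s) := by
        rw [← chord_mul φ hXs.2]
        exact mul_le_mul_of_nonneg_right (h.chord_phi_le hXs) h1s.le
      have g5 : b * (1 - X s) ≤ ψ (X s) := by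
        rw [← chord_mul ψ hXs.2]
        exact mul_le_mul_of_nonneg_right (h.le_chord_psi hXs) h1s.le
      have g6 := mul_le_mul_of_nonneg_left g5 hκ
      have g7 : L / b * (κ s * (b * (1 - X s)) - a * (1 - X s)) ≤
          L / b * (-(φ (X s) - κ s * ψ (X s))) :=
        mul_le_mul_of_nonneg_left (by linarith) (by positivity)
      have g8 : L / b * (κ s * (b * (1 - X s)) - a * (1 - X s)) =
          κ s * (L * (1 - X s)) - L * (a / b) * (1 - X s) := by
        field_simp
      have g9 : L * (1 + a / b) * (1 - X s) ≤ L * (1 + a / b) * (D * Real.exp (-(t - s) / q)) :=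
        mul_le_mul_of_nonneg_left (hdecay s hst') (by positivity)
      have g10 : L * (1 + a / b) * (1 - X s) = L * (1 - X s) + L * (a / b) * (1 - X s) := by ring
      linarith)
    simp only [hΘ0, mul_zero, sub_self, neg_zero, zero_div, Real.exp_zero, mul_one, sub_zero]
      at key
    have h1 : L / b * (1 - X t) ≤ L / b * 1 :=
      mul_le_mul_of_nonneg_left (by linarith [hXt.1]) (by positivity)
    have h2 : 0 ≤ L / b * (1 - X 0) :=
      mul_nonneg (by positivity) (by linarith [hX0.2])
    have h3 : 0 ≤ L * (1 + a / b) * (q * (D * Real.exp (-t / q))) := by positivity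
    linarith

/-! ### Uniform decrease of the solution across the interval -/

/-- At all times `w` drops by a factor of two across a fixed part of the interval: the initial
values of two characteristics have about the same ratio of distances to `1` as their end points. -/
theorem exists_le_half (h : Coefficients φ ψ) (hc₀ : InitialDensity c₀) {β₀ : ℝ}
    (hβ₀ : 0 < β₀) (hβ₁ : β₀ < 1) (hβ : Tendsto (beta c₀) (𝓝[<] 1) (𝓝 β₀)) :
    ∃ y ∈ Ico (1 / 2 : ℝ) 1, ∀ (w : ℝ → ℝ → ℝ) (κ : ℝ → ℝ), IsSolution φ ψ c₀ w κ →
      ∀ t, 0 ≤ t → ∀ x ∈ Icc (0 : ℝ) (1 / 2), w y t ≤ w x t / 2 := by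
  obtain ⟨ρ, hρ, hρW⟩ := hc₀.exists_tail_le_half hβ₀ hβ₁ hβ
  obtain ⟨K, hK⟩ := exists_linearExpansion_bound h hc₀ hβ₀ hβ₁ hβ
  -- The end point is `1 - ρ E / 2`: the factor `E` absorbs the error of the linearization, and `1/2`
  -- the loss from `1` to `1 - x ≥ 1/2`.
  set E := Real.exp (-max K 0) with hE
  have hE0 : 0 < E := Real.exp_pos _
  have hE1 : E ≤ 1 := Real.exp_le_one_iff.2 (neg_nonpos.2 (le_max_right _ _))
  have hρE : 0 < ρ * E := mul_pos hρ.1 hE0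
  have hρE1 : ρ * E ≤ 1 := mul_le_one₀ hρ.2.le hE0.le hE1
  have hy : 1 - ρ * E / 2 ∈ Ico (1 / 2 : ℝ) 1 := ⟨by linarith, by linarith⟩
  refine ⟨1 - ρ * E / 2, hy, fun w κ hs t ht x hx => ?_⟩
  obtain ⟨X, hX, rfl, hwX⟩ := hs.exists_characteristic ht
    (show x ∈ Ico (0 : ℝ) 1 from ⟨hx.1, by linarith [hx.2]⟩)
  obtain ⟨Y, hY, hYt, hwY⟩ := hs.exists_characteristic ht
    (show 1 - ρ * E / 2 ∈ Ico (0 : ℝ) 1 from ⟨by linarith [hy.1], hy.2⟩)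
  have hX0 := (hX 0 ⟨le_rfl, ht⟩).1
  have hY0 := (hY 0 ⟨le_rfl, ht⟩).1
  have h1X : 0 < 1 - X 0 := sub_pos.2 hX0.2
  have h1Y : 0 < 1 - Y 0 := sub_pos.2 hY0.2
  have h1 := (hK w κ hs t X ht hX hwX).2
  have h2 := (hK w κ hs t Y ht hY hwY).1
  rw [← hYt, hwX t ⟨ht, le_rfl⟩, hwY t ⟨ht, le_rfl⟩]
  rw [hYt, sub_sub_cancel, Real.log_div hρE.ne' two_ne_zero,
    Real.log_mul hρ.1.ne' hE0.ne', hE, Real.log_exp] at h2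
  have h3 : Real.log (1 / 2) ≤ Real.log (1 - X t) :=
    Real.log_le_log (by norm_num) (by linarith [hx.2])
  rw [one_div, Real.log_inv] at h3
  have h4 : 1 - Y 0 ≤ ρ * (1 - X 0) := by
    rw [← Real.log_le_log_iff h1Y (mul_pos hρ.1 h1X), Real.log_mul hρ.1.ne' h1X.ne']
    linarith [le_max_left K 0]
  have h5 : tail c₀ (Y 0) ≤ tail c₀ (1 - ρ * (1 - X 0)) := by
    refine hc₀.tail_antitoneOn ⟨?_, ?_⟩ (Ico_subset_Icc_self hY0) (by linarith)
    · nlinarith [hρ.2, hX0.1, hρ.1]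
    · nlinarith [hρ.1]
  have h6 := mul_le_mul_of_nonneg_left (h5.trans (hρW _ hX0)) (Real.exp_pos t).le
  linarith

/-- Near `0`, `w` exceeds its mean value `1` by a fixed amount, at all times, since it is
decreasing and at most half as large on a fixed interval near `1`. -/
theorem exists_one_add_le (h : Coefficients φ ψ) (hc₀ : InitialDensity c₀) {β₀ : ℝ}
    (hβ₀ : 0 < β₀) (hβ₁ : β₀ < 1) (hβ : Tendsto (beta c₀) (𝓝[<] 1) (𝓝 β₀)) :
    ∃ δ₀ ε : ℝ, 0 < δ₀ ∧ δ₀ < 1 ∧ 0 < ε ∧ ∀ (w : ℝ → ℝ → ℝ) (κ : ℝ → ℝ), IsSolution φ ψ c₀ w κ →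
      ∀ t, 0 ≤ t → ∀ δ ∈ Icc 0 δ₀, 1 + ε ≤ w δ t := by
  obtain ⟨M, q, hq, hMq⟩ := hc₀.exists_log_tail_ge hβ₀ hβ₁ hβ
  obtain ⟨y, hy, hhalf⟩ := exists_le_half h hc₀ hβ₀ hβ₁ hβ
  set A := Real.exp ((1 + q) * Real.log 2 + M) with hA
  have hA0 : 0 < A := Real.exp_pos _
  set η := (1 - y) / 2 with hη
  have hη0 : 0 < η := by linarith [hy.2]
  refine ⟨min (1 / 2) (η / 2 / A), η / 2, lt_min (by norm_num) (by positivity),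
    (min_le_left _ _).trans_lt (by norm_num), by positivity, fun w κ hs t ht δ hδ => ?_⟩
  have hδ1 : δ ≤ 1 / 2 := hδ.2.trans (min_le_left _ _)
  have hδA : δ * A ≤ η / 2 := by
    rw [← le_div_iff₀ hA0]
    exact hδ.2.trans (min_le_right _ _)
  have hδ0 : δ ∈ Ico (0 : ℝ) 1 := ⟨hδ.1, by linarith⟩
  have hy0 : y ∈ Ico (0 : ℝ) 1 := ⟨by linarith [hy.1], hy.2⟩
  have h1 := hs.integral_add ht (Ico_subset_Icc_self hδ0)
  have h2 := hs.integral_le h hc₀ ht (x := 0) (by simp) hδ0.2.le hδ0.1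
  have h3 := hs.integral_le h hc₀ ht hδ0 hy0.2.le (hδ1.trans hy.1)
  have h4 := hs.integral_le h hc₀ ht hy0 le_rfl hy0.2.le
  have h5 : (∫ z in δ..y, w z t) + (∫ z in y..1, w z t) = ∫ z in δ..1, w z t :=
    intervalIntegral.integral_add_adjacent_intervals
      (hs.intervalIntegrable ht (Ico_subset_Icc_self hδ0) (Ico_subset_Icc_self hy0))
      (hs.intervalIntegrable ht (y := 1) (Ico_subset_Icc_self hy0) (by simp))
  have h6 : w 0 t ≤ A :=
    (Real.log_le_iff_le_exp (hs.pos hc₀ ht (by simp))).1 (hs.log_zero_le h hc₀ hq hMq ht)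
  have h7 := mul_le_mul_of_nonneg_left (hhalf w κ hs t ht δ ⟨hδ.1, hδ1⟩) (show 0 ≤ 1 - y by linarith)
  have h8 := mul_le_mul_of_nonneg_left h6 hδ.1
  have hw := hs.pos hc₀ ht hδ0
  have h9 := mul_nonneg hδ.1 hw.le
  have h10 : 1 - η / 2 ≤ w δ t * (1 - η) := by
    rw [hη] at hδA ⊢
    linarith
  have h11 : (1 + η / 2) * (1 - η) ≤ 1 - η / 2 := by nlinarith
  exact le_of_mul_le_mul_right (h11.trans h10) (by linarith [hy.1])

/-! ### Bounds on `κ` -/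

/-- If `κ` were small on a short time interval, the outflow at `0`, which is controlled by `κ` and
by the bounded value `w(0,t)`, could not balance the exponential growth of `w` along
characteristics, and the mass of `w` would exceed `1`. -/
theorem exists_kappa_ge (h : Coefficients φ ψ) (hc₀ : InitialDensity c₀) {β₀ : ℝ}
    (hβ₀ : 0 < β₀) (hβ₁ : β₀ < 1) (hβ : Tendsto (beta c₀) (𝓝[<] 1) (𝓝 β₀)) :
    ∃ C : ℝ, 0 < C ∧ ∀ (w : ℝ → ℝ → ℝ) (κ : ℝ → ℝ), IsSolution φ ψ c₀ w κ →
      ∀ t, 0 ≤ t → C ≤ κ t := by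
  obtain ⟨M, q, hq, hMq⟩ := hc₀.exists_log_tail_ge hβ₀ hβ₁ hβ
  set A := Real.exp ((1 + q) * Real.log 2 + M) with hA
  have hA0 : 0 < A := Real.exp_pos _
  have hψ := h.psi_zero_pos
  -- With this constant at most half of the mass created in a short time can leave through `0`.
  refine ⟨1 / (2 * A * ψ 0), by positivity, fun w κ hs t ht => ?_⟩
  by_contra! hlt
  set C := 1 / (2 * A * ψ 0) with hC
  have hnear : ∀ᶠ s in 𝓝[≥] t, κ s < C :=
    ((hs.cont t ht).mono (fun s hs' => ht.trans (mem_Ici.1 hs'))).eventually_lt_const hlt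
  obtain ⟨u, hu, hus⟩ := (mem_nhdsGE_iff_exists_Ico_subset).1 hnear
  obtain ⟨r, hr⟩ := exists_between (lt_min (mem_Ioi.1 hu) (lt_add_one t))
  obtain ⟨hrt, hru, hr1⟩ : t < r ∧ r < u ∧ r < t + 1 :=
    ⟨hr.1, hr.2.trans_le (min_le_left _ _), hr.2.trans_le (min_le_right _ _)⟩
  have hr0 : 0 ≤ r := ht.trans hrt.le
  have hw0 : w 0 t ≤ A :=
    (Real.log_le_iff_le_exp (hs.pos hc₀ ht (by simp))).1 (hs.log_zero_le h hc₀ hq hMq ht)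
  have hA1 : 1 ≤ A := (hs.one_le_zero h hc₀ ht).trans hw0
  set δ := (r - t) * (C * ψ 0) with hδ
  have hδA : δ * A = (r - t) / 2 := by
    rw [hδ, hC]
    field_simp
  have hδ0 : 0 < δ := mul_pos (sub_pos.2 hrt) (by positivity)
  have hδ1 : δ < 1 := by nlinarith
  have hcmp : ∀ x ∈ Ioo 0 (1 - δ), Real.exp (r - t) * w (x + δ) t ≤ w x r := by
    intro x hx
    have hx0 : x ∈ Ico (0 : ℝ) 1 := ⟨hx.1.le, by linarith [hx.2]⟩
    obtain ⟨X, hX, hXr, hwX⟩ := hs.exists_characteristic hr0 hx0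
    have htr : t ∈ Icc 0 r := ⟨ht, hrt.le⟩
    have hmv := sub_le_mul_of_hasDerivAt_le (C := C * ψ 0) hrt.le
      ((hX.continuousOn.mono (Icc_subset_Icc_left ht)).neg)
      (fun s hs' => (hX.hasDerivAt ⟨ht.trans_lt hs'.1, hs'.2⟩).neg) (fun s hs' => by
        have hXs := (hX s ⟨ht.trans hs'.1.le, hs'.2.le⟩).1
        have g1 := h.phi_nonneg hXs
        have g2 : κ s < C := hus ⟨hs'.1.le, hs'.2.trans hru⟩
        have g3 : κ s * ψ (X s) ≤ C * ψ 0 :=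
          mul_le_mul g2.le (h.psi_le hXs) (h.psi_nonneg hXs) (by positivity)
        linarith)
    simp only [Pi.neg_apply, hXr] at hmv
    have hXt := (hX t htr).1
    have hle : w (x + δ) t ≤ w (X t) t :=
      hs.antitoneOn h hc₀ ht hXt ⟨by linarith [hx.1], by linarith [hx.2]⟩ (by linarith)
    calc Real.exp (r - t) * w (x + δ) t ≤ Real.exp (r - t) * w (X t) t :=
          mul_le_mul_of_nonneg_left hle (Real.exp_pos _).le
      _ = w x r := by
          rw [hwX t htr, ← mul_assoc, ← Real.exp_add, sub_add_cancel, ← hXr,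
            hwX r ⟨hr0, le_rfl⟩]
  have hδm : δ ∈ Icc (0 : ℝ) 1 := ⟨hδ0.le, hδ1.le⟩
  have hδm' : 1 - δ ∈ Icc (0 : ℝ) 1 := ⟨by linarith, by linarith⟩
  have hshift : ∫ x in (0 : ℝ)..(1 - δ), w (x + δ) t = ∫ x in δ..1, w x t := by
    have := intervalIntegral.integral_comp_add_right (a := 0) (b := 1 - δ) (fun x => w x t) δ
    simpa using this
  have hint : IntervalIntegrable (fun x => w (x + δ) t) volume 0 (1 - δ) := by
    have := (hs.intervalIntegrable ht (y := 1) hδm (by simp)).comp_add_right δ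
    simpa using this
  have h1 := intervalIntegral.integral_mono_on_of_le_Ioo hδm'.1 (hint.const_mul _)
    (hs.intervalIntegrable hr0 (x := 0) (by simp) hδm') hcmp
  rw [intervalIntegral.integral_const_mul, hshift] at h1
  have h2 := hs.integral_add ht hδm
  have h3 := hs.integral_le h hc₀ ht (x := 0) (by simp) hδ1.le hδ0.le
  have h4 := hs.integral_add hr0 hδm'
  have h5 := hs.integral_nonneg hc₀ hr0 (x := 1 - δ) (y := 1) hδm'.1 le_rfl (by linarith)
  have h6 := mul_le_mul_of_nonneg_left hw0 hδ0.le
  have h7 : 1 - (r - t) / 2 ≤ ∫ x in δ..1, w x t := by linarith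
  have h8 := Real.add_one_le_exp (r - t)
  have h9 : (r - t + 1) * (1 - (r - t) / 2) ≤ Real.exp (r - t) * ∫ x in δ..1, w x t :=
    mul_le_mul h8 h7 (by linarith) (Real.exp_pos _).le
  nlinarith

/-- If `κ` were large on a short time interval, the outflow at `0` would exceed the growth of
`w`, because `w` is larger near `0` than on average. -/
theorem exists_kappa_le (h : Coefficients φ ψ) (hc₀ : InitialDensity c₀) {β₀ : ℝ}
    (hβ₀ : 0 < β₀) (hβ₁ : β₀ < 1) (hβ : Tendsto (beta c₀) (𝓝[<] 1) (𝓝 β₀)) :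
    ∃ C : ℝ, 0 < C ∧ ∀ (w : ℝ → ℝ → ℝ) (κ : ℝ → ℝ), IsSolution φ ψ c₀ w κ →
      ∀ t, 0 ≤ t → κ t ≤ C := by
  obtain ⟨δ₀, ε, hδ₀, hδ₀1, hε, hw⟩ := exists_one_add_le h hc₀ hβ₀ hβ₁ hβ
  set a := -derivWithin φ (Ioc 0 1) 1 with ha
  set b := -derivWithin ψ (Ioc 0 1) 1 with hb
  have ha0 : 0 < a := by linarith [h.deriv_phi_lt]
  have hb0 : 0 < b := by linarith [h.deriv_psi_lt]
  -- With this constant distances to `1` grow at least at the logarithmic rate `3 / ε`.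
  refine ⟨(a + 3 / ε) / b, by positivity, fun w κ hs t ht => ?_⟩
  by_contra! hlt
  set C := (a + 3 / ε) / b with hC
  have hnear : ∀ᶠ s in 𝓝[≥] t, C < κ s :=
    ((hs.cont t ht).mono (fun s hs' => ht.trans (mem_Ici.1 hs'))).eventually_const_lt hlt
  obtain ⟨u, hu, hus⟩ := (mem_nhdsGE_iff_exists_Ico_subset).1 hnear
  obtain ⟨r, hr⟩ := exists_between
    (lt_min (mem_Ioi.1 hu) (show t < t + δ₀ * ε / 3 by linarith [mul_pos hδ₀ hε]))
  obtain ⟨hrt, hru, hr1⟩ : t < r ∧ r < u ∧ r < t + δ₀ * ε / 3 :=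
    ⟨hr.1, hr.2.trans_le (min_le_left _ _), hr.2.trans_le (min_le_right _ _)⟩
  have hr0 : 0 ≤ r := ht.trans hrt.le
  set y := (r - t) * (3 / ε) with hy
  have hyε : y * ε = 3 * (r - t) := by rw [hy]; field_simp
  have hy0 : 0 < y := mul_pos (sub_pos.2 hrt) (by positivity)
  have hyδ : y ≤ δ₀ := by
    refine le_of_mul_le_mul_right ?_ hε
    linarith
  set θ := Real.exp (-y) with hθ
  have hθ0 : 0 < θ := Real.exp_pos _
  have hθ1 : θ < 1 := Real.exp_lt_one_iff.2 (by linarith)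
  have hθy : 1 - θ ≤ y := by linarith [Real.add_one_le_exp (-y)]
  have hθm : 1 - θ ∈ Ico (0 : ℝ) 1 := ⟨by linarith, by linarith⟩
  have hcmp : ∀ x ∈ Ioo (0 : ℝ) 1, w x r ≤ Real.exp (r - t) * w ((1 - θ) + θ * x) t := by
    intro x hx
    obtain ⟨X, hX, hXr, hwX⟩ := hs.exists_characteristic hr0 (Ioo_subset_Ico_self hx)
    have htr : t ∈ Icc 0 r := ⟨ht, hrt.le⟩
    have hmv := sub_le_mul_of_hasDerivAt_le (C := -(3 / ε)) hrt.le
      ((hX.log_continuousOn.mono (Icc_subset_Icc_left ht)).neg)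
      (fun s hs' => (hX.log_hasDerivAt ⟨ht.trans_lt hs'.1, hs'.2⟩).neg) (fun s hs' => by
        have hXs := (hX s ⟨ht.trans hs'.1.le, hs'.2.le⟩).1
        have g1 := h.chord_phi_le hXs
        have g2 : C < κ s := hus ⟨hs'.1.le, hs'.2.trans hru⟩
        have g3 : C * b ≤ κ s * chord ψ (X s) :=
          mul_le_mul g2.le (h.le_chord_psi hXs) hb0.le (hs.kappa_nonneg h (ht.trans hs'.1.le))
        have g4 : C * b = a + 3 / ε := div_mul_cancel₀ _ hb0.ne'
        linarith)
    simp only [Pi.neg_apply, hXr] at hmv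
    have hXt := (hX t htr).1
    have h1x : 0 < 1 - x := sub_pos.2 hx.2
    have hle' : 1 - X t ≤ θ * (1 - x) := by
      rw [← Real.log_le_log_iff (sub_pos.2 hXt.2) (mul_pos hθ0 h1x),
        Real.log_mul hθ0.ne' h1x.ne', hθ, Real.log_exp]
      linarith
    have hp := mul_pos hθ0 h1x
    have hp' := mul_pos hθ0 hx.1
    have hle : w (X t) t ≤ w ((1 - θ) + θ * x) t :=
      hs.antitoneOn h hc₀ ht ⟨by linarith, by linarith⟩ hXt (by linarith)
    calc w x r = Real.exp (r - t) * w (X t) t := by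
          rw [hwX t htr, ← mul_assoc, ← Real.exp_add, sub_add_cancel, ← hXr,
            hwX r ⟨hr0, le_rfl⟩]
      _ ≤ _ := mul_le_mul_of_nonneg_left hle (Real.exp_pos _).le
  have hshift : ∫ x in (0 : ℝ)..1, w ((1 - θ) + θ * x) t = θ⁻¹ * ∫ x in (1 - θ)..1, w x t := by
    have := intervalIntegral.integral_comp_add_mul (a := 0) (b := 1) (fun x => w x t) hθ0.ne'
      (1 - θ)
    simpa using this
  have hint : IntervalIntegrable (fun x => w ((1 - θ) + θ * x) t) volume 0 1 := by
    have h1 := (hs.intervalIntegrable ht (y := 1) (Ico_subset_Icc_self hθm)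
      (by simp)).comp_add_left (1 - θ)
    have h2 := h1.comp_mul_left (c := θ)
    simpa [hθ0.ne'] using h2
  have h1 := intervalIntegral.integral_mono_on_of_le_Ioo zero_le_one
    (hs.intervalIntegrable hr0 (x := 0) (y := 1) (by simp) (by simp)) (hint.const_mul _) hcmp
  rw [intervalIntegral.integral_const_mul, hshift, hs.mass r hr0] at h1
  have h2 := hs.integral_add ht (Ico_subset_Icc_self hθm)
  have h3 := hs.le_integral h hc₀ ht (x := 0) le_rfl hθm.2 hθm.1
  have h4 := mul_le_mul_of_nonneg_left (hw w κ hs t ht (1 - θ) ⟨hθm.1, hθy.trans hyδ⟩) hθm.1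
  have h5 : ∫ x in (1 - θ)..1, w x t ≤ θ - (1 - θ) * ε := by linarith
  -- The mass of `w` at time `r` is at most `e^(r-t) (1 - (1/θ - 1) ε)`, where `1/θ - 1 ≥ y`.
  have h6 : y * θ ≤ 1 - θ := by
    have e1 := mul_le_mul_of_nonneg_right (Real.add_one_le_exp y) hθ0.le
    rw [hθ, ← Real.exp_add, add_neg_cancel, Real.exp_zero, ← hθ] at e1
    linarith
  have h7 : θ⁻¹ * ∫ x in (1 - θ)..1, w x t ≤ 1 - 3 * (r - t) := by
    rw [inv_mul_le_iff₀ hθ0, ← hyε]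
    have := mul_le_mul_of_nonneg_right h6 hε.le
    linarith
  have h8 : Real.exp (r - t) * (1 - 3 * (r - t)) < 1 := by
    have e1 := Real.add_one_le_exp (-(r - t))
    have e2 : 1 - 3 * (r - t) < Real.exp (-(r - t)) := by linarith
    calc Real.exp (r - t) * (1 - 3 * (r - t)) < Real.exp (r - t) * Real.exp (-(r - t)) :=
          mul_lt_mul_of_pos_left e2 (Real.exp_pos _)
      _ = 1 := by rw [← Real.exp_add, add_neg_cancel, Real.exp_zero]
  have h9 := mul_le_mul_of_nonneg_left h7 (Real.exp_pos (r - t)).le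
  linarith

/-! ### The time average of `κ` -/

/-- Let `z` be the initial point of the characteristic that ends at `(0,t)`. Boundedness of `w(0,t)`
gives `log w₀(z) = -t + O(1)`, and comparison with the linearized flow gives
`-log (1 - z) = b ∫₀ᵗ κ - a t + O(1)`. The decay exponent of `w₀` at `1` relates the two. -/
theorem tendsto_average_kappa (h : Coefficients φ ψ) (hc₀ : InitialDensity c₀) {β₀ : ℝ}
    (hβ₀ : 0 < β₀) (hβ₁ : β₀ < 1) (hβ : Tendsto (beta c₀) (𝓝[<] 1) (𝓝 β₀))
    (hs : IsSolution φ ψ c₀ w κ) :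
    Tendsto (fun T : ℝ => (1 / T) * ∫ t in (0 : ℝ)..T, κ t) atTop
      (𝓝 ((1 / β₀ - derivWithin φ (Ioc 0 1) 1 - 1) / |derivWithin ψ (Ioc 0 1) 1|)) := by
  obtain ⟨M, q, hq, hMq⟩ := hc₀.exists_log_tail_ge hβ₀ hβ₁ hβ
  obtain ⟨K, hK⟩ := exists_linearExpansion_bound h hc₀ hβ₀ hβ₁ hβ
  set Λ := (1 + q) * Real.log 2 + M
  have hex : ∀ t : ℝ, ∃ z : ℝ, 0 ≤ t → z ∈ Ico (0 : ℝ) 1 ∧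
      -t ≤ Real.log (tail c₀ z) ∧ Real.log (tail c₀ z) ≤ -t + Λ ∧
      linearExpansion φ ψ κ t ≤ -Real.log (1 - z) ∧
      -Real.log (1 - z) ≤ linearExpansion φ ψ κ t + K := by
    intro t
    by_cases ht : 0 ≤ t
    · obtain ⟨X, hX, hXt, hwX⟩ := hs.exists_characteristic ht (by simp : (0 : ℝ) ∈ Ico (0 : ℝ) 1)
      have hX0 := (hX 0 ⟨le_rfl, ht⟩).1
      have h1 := hK w κ hs t X ht hX hwX
      rw [hXt, sub_zero, Real.log_one, zero_sub] at h1
      have h2 : Real.log (w 0 t) = t + Real.log (tail c₀ (X 0)) := by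
        have e := hwX t ⟨ht, le_rfl⟩
        rw [hXt] at e
        rw [e, Real.log_mul (Real.exp_pos t).ne' (hc₀.tail_pos _ hX0).ne', Real.log_exp]
      have h3 := Real.log_nonneg (hs.one_le_zero h hc₀ ht)
      have h4 := hs.log_zero_le h hc₀ hq hMq ht
      exact ⟨X 0, fun _ => ⟨hX0, by linarith, by linarith, h1⟩⟩
    · exact ⟨0, fun h0 => absurd h0 ht⟩
  choose z hz using hex
  have hpos := eventually_ge_atTop (0 : ℝ)
  have hlogz : Tendsto (fun t => Real.log (1 - z t)) atTop atBot := by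
    have hb : Tendsto (fun t : ℝ => (-t + (Λ + M - Real.log (tail c₀ 0))) / q) atTop atBot :=
      (tendsto_neg_atTop_atBot.atBot_add tendsto_const_nhds).atBot_div_const hq
    refine tendsto_atBot_mono' _ ?_ hb
    filter_upwards [hpos] with t ht
    obtain ⟨h1, -, h2, -⟩ := hz t ht
    have h3 := hMq 0 (by simp) (z t) h1
    rw [sub_zero, Real.log_one, sub_zero] at h3
    rw [le_div_iff₀ hq]
    linarith
  have hz1 : Tendsto z atTop (𝓝[<] 1) := by
    refine tendsto_nhdsWithin_iff.2 ⟨?_, hpos.mono fun t ht => (hz t ht).1.2⟩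
    have h1 := (Real.tendsto_exp_atBot.comp hlogz).const_sub 1
    rw [sub_zero] at h1
    refine h1.congr' ?_
    filter_upwards [hpos] with t ht
    simp only [Function.comp_apply]
    rw [Real.exp_log (sub_pos.2 (hz t ht).1.2), sub_sub_cancel]
  have hratio := (hc₀.tendsto_log_tail_div hβ₀ hβ₁ hβ).comp hz1
  have hconst : ∀ C : ℝ, Tendsto (fun t : ℝ => C / t) atTop (𝓝 0) := fun C =>
    tendsto_const_nhds.div_atTop tendsto_id
  have hW : Tendsto (fun t => Real.log (tail c₀ (z t)) / t) atTop (𝓝 (-1)) := by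
    have hup : Tendsto (fun t : ℝ => -1 + Λ / t) atTop (𝓝 (-1)) := by
      simpa using (hconst Λ).const_add (-1)
    refine tendsto_of_tendsto_of_tendsto_of_le_of_le' tendsto_const_nhds hup ?_ ?_
    · filter_upwards [eventually_gt_atTop (0 : ℝ)] with t ht
      rw [le_div_iff₀ ht]
      linarith [(hz t ht.le).2.1]
    · filter_upwards [eventually_gt_atTop (0 : ℝ)] with t ht
      rw [div_le_iff₀ ht, add_mul, div_mul_cancel₀ _ ht.ne']
      linarith [(hz t ht.le).2.2.1]
  have hp : (1 - β₀)⁻¹ - 1 = β₀ / (1 - β₀) := by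
    have : 1 - β₀ ≠ 0 := by linarith
    field_simp
    ring
  have hp0 : β₀ / (1 - β₀) ≠ 0 := (div_pos hβ₀ (by linarith)).ne'
  rw [hp] at hratio
  have hlim : Tendsto (fun t => -Real.log (1 - z t) / t) atTop (𝓝 (1 / β₀ - 1)) := by
    have h1 := (hW.div hratio hp0).neg
    have h2 : -(-1 / (β₀ / (1 - β₀))) = 1 / β₀ - 1 := by
      have : 1 - β₀ ≠ 0 := by linarith
      field_simp
    rw [h2] at h1
    refine h1.congr' ?_
    filter_upwards [eventually_gt_atTop (0 : ℝ), hlogz.eventually_lt_atBot 0,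
      hW.eventually_lt_const (show (-1 : ℝ) < 0 by norm_num)] with t ht h3 h4
    have h5 : Real.log (tail c₀ (z t)) ≠ 0 := fun h0 => by simp [h0] at h4
    have h6 := h3.ne
    simp only [Pi.div_apply, Function.comp_apply]
    field_simp
  have hΘ : Tendsto (fun t => linearExpansion φ ψ κ t / t) atTop (𝓝 (1 / β₀ - 1)) := by
    have hlow : Tendsto (fun t => -Real.log (1 - z t) / t - K / t) atTop (𝓝 (1 / β₀ - 1)) := by
      simpa using hlim.sub (hconst K)
    refine tendsto_of_tendsto_of_tendsto_of_le_of_le' hlow hlim ?_ ?_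
    · filter_upwards [eventually_gt_atTop (0 : ℝ)] with t ht
      rw [← sub_div]
      exact div_le_div_of_nonneg_right (by linarith [(hz t ht.le).2.2.2.2]) ht.le
    · filter_upwards [eventually_gt_atTop (0 : ℝ)] with t ht
      exact div_le_div_of_nonneg_right (hz t ht.le).2.2.2.1 ht.le
  have hψ := h.deriv_psi_lt
  have hfin := (hΘ.add_const (-derivWithin φ (Ioc 0 1) 1)).div_const
    (-derivWithin ψ (Ioc 0 1) 1)
  rw [abs_of_neg hψ]
  have hval : 1 / β₀ - derivWithin φ (Ioc 0 1) 1 - 1 =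
      1 / β₀ - 1 + -derivWithin φ (Ioc 0 1) 1 := by ring
  rw [hval]
  refine hfin.congr' ?_
  filter_upwards [eventually_gt_atTop (0 : ℝ)] with t ht
  rw [linearExpansion]
  have := hψ.ne
  field_simp
  ring

end IsSolution

end LSW

theorem theorem1p1 (φ ψ c₀ : ℝ → ℝ) (β₀ : ℝ)
    (hcoef : LSW.Coefficients φ ψ) (hc₀ : LSW.InitialDensity c₀)
    (hβ₀_pos : 0 < β₀) (hβ₀_lt : β₀ < 1)
    (hβ : Tendsto (LSW.beta c₀) (𝓝[<] 1) (𝓝 β₀)) :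
    (∃ C₁ : ℝ, 0 < C₁ ∧ ∀ (w : ℝ → ℝ → ℝ) (κ : ℝ → ℝ), LSW.IsSolution φ ψ c₀ w κ →
      ∀ t : ℝ, 0 ≤ t → C₁ ≤ κ t) ∧
    (LSW.ThirdOrder φ ψ →
      (∃ C₂ : ℝ, 0 < C₂ ∧ ∀ (w : ℝ → ℝ → ℝ) (κ : ℝ → ℝ), LSW.IsSolution φ ψ c₀ w κ →
        ∀ t : ℝ, 0 ≤ t → κ t ≤ C₂) ∧
      ∀ (w : ℝ → ℝ → ℝ) (κ : ℝ → ℝ), LSW.IsSolution φ ψ c₀ w κ →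
        Tendsto (fun T : ℝ => (1 / T) * ∫ t in (0 : ℝ)..T, κ t) atTop
          (𝓝 ((1 / β₀ - derivWithin φ (Ioc 0 1) 1 - 1) / |derivWithin ψ (Ioc 0 1) 1|))) :=
  ⟨LSW.IsSolution.exists_kappa_ge hcoef hc₀ hβ₀_pos hβ₀_lt hβ, fun _ =>
    ⟨LSW.IsSolution.exists_kappa_le hcoef hc₀ hβ₀_pos hβ₀_lt hβ, fun _ _ hs =>
      LSW.IsSolution.tendsto_average_kappa hcoef hc₀ hβ₀_pos hβ₀_lt hβ hs⟩⟩
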